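/- Fix a probability space, matrices $A\in\mathbb R^{n\times n}$, $B\in\mathbb R^{n\times p}$, $C\in\mathbb R^{m\times n}$, symmetric $Q\succeq 0$ ($n\times n$) and $R\succ 0$ ($p\times p$), a deterministic $x_0\in\mathbb R^n$ and a horizon $N\in\mathbb N$. Let $(w_t,v_t)_{t\ge 0}$ be i.i.d. across time with values in $\mathbb R^n\times\mathbb R^m$ (arbitrary joint law), with $\mathbb E\|w_t\|^q<\infty$ for every $q\ge 1$; put $\bar w=\mathbb E w_t$. For inputs $u=(u_0,\dots,u_{N-1})$ let $$x_{t+1}=Ax_t+Bu_t+w_{t+1},\qquad y_t=Cx_t+v_t,\qquad \mathcal F_t=\sigma(y_{0:t},u_{0:t}).$$ The set $\mathcal U_0$ of admissible policies consists of all $u$ such that each $u_t\in\mathbb R^p$ is measurable with respect to the available information $\sigma(y_{0:t},u_{0:t-1})$ and has a finite fourth moment. Write (the dependence on $u$ is suppressed) $$\hat x_{t|t}=\mathbb E(x_t|\mathcal F_t),\quad \hat x_t=\mathbb E(x_t|\mathcal F_{t-1}),\quad \delta_t=x_t-\hat x_t,\quad e_t=\hat x_{t|t}-\hat x_t,$$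 $$W_t=\mathbb E(\delta_{t+1}\delta_{t+1}'|\mathcal F_t),\quad m_{3,t}=2Q\,\mathbb E(\delta_{t+1}\delta_{t+1}'Q\delta_{t+1}|\mathcal F_t),$$ $$J(u)=\mathbb E\Big\{x_N'Qx_N+\sum_{t=0}^{N-1}(x_t'Qx_t+u_t'Ru_t)\Big\},\quad J_R(u)=\mathbb E\sum_{t=1}^{N}\big(4\hat x_t'QW_{t-1}Q\hat x_t+2\hat x_t'm_{3,t-1}\big).$$ For $\bar\epsilon\in\mathbb R$ consider the risk-constrained problem of minimizing $J(u)$ over $u\in\mathcal U_0$ subject to $J_R(u)\le\bar\epsilon$. For $\mu\ge 0$ define, backwards in $t=N-1,\dots,0$ from $P_N=0$, $\zeta_N=0$, $$V_t=\mathbb E(P_{t+1}|\mathcal F_t)+Q+4\mu QW_tQ,\qquad \xi_t=\mathbb E(P_{t+1}e_{t+1}+\zeta_{t+1}|\mathcal F_t)+\mu m_{3,t},$$ $$K_t=-(B'V_tB+R)^{-1}B'V_tA,\qquad l_t=-(B'V_tB+R)^{-1}B'(\xi_t+V_t\bar w),$$ $$P_t=(A+BK_t)'V_t(A+BK_t)+K_t'RK_t,\qquad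 \zeta_t=(A+BK_t)'(\xi_t+V_t\bar w).$$ Let $u^*(\mu)$ denote a policy in $\mathcal U_0$ whose closed loop satisfies $u_t=K_t\hat x_{t|t}+l_t$ almost surely for all $t\le N-1$. **Theorem.** For every $\mu\ge 0$ a controller $u^*(\mu)\in\mathcal U_0$ as above exists. For any choice of $u^*(\mu)$, $\mu\ge0$, and every $\bar\epsilon>\bar\epsilon_{\inf}:=\inf_{u\in\mathcal U_0}J_R(u)$, the risk-constrained problem is feasible, the set $\{\mu\ge 0: J_R(u^*(\mu))\le\bar\epsilon\}$ is non-empty, and with $$\mu^*=\inf\{\mu\ge 0: J_R(u^*(\mu))\le\bar\epsilon\}$$ the policy $u^*(\mu^*)$ is an optimal solution of the risk-constrained problem; every optimal solution coincides with it almost surely at each time $t\le N-1$. -/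

import Mathlib

open MeasureTheory ProbabilityTheory Matrix

/-- The data of a partially observed linear-quadratic control problem on a sample space `Ω`:
`x_{t+1} = A x_t + B u_t + w_{t+1}`, `y_t = C x_t + v_t`, state penalty `Q`, input penalty `R`,
deterministic initial state `x0`, horizon `N`. (Only data; the assumptions on the data are
hypotheses of the theorem.) -/
structure LQProblem (Ω : Type*) (n m p : ℕ) where
  A : Matrix (Fin n) (Fin n) ℝ
  B : Matrix (Fin n) (Fin p) ℝ
  C : Matrix (Fin m) (Fin n) ℝ
  Q : Matrix (Fin n) (Fin n) ℝ
  R : Matrix (Fin p) (Fin p) ℝ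
  x0 : Fin n → ℝ
  N : ℕ
  w : ℕ → Ω → (Fin n → ℝ)
  v : ℕ → Ω → (Fin m → ℝ)

namespace LQProblem

noncomputable section

/-- Entrywise conditional expectation of a random vector. -/
def condVec {Ω : Type*} [MeasurableSpace Ω] (Pr : Measure Ω) {k : ℕ} (F : MeasurableSpace Ω)
    (f : Ω → (Fin k → ℝ)) : Ω → (Fin k → ℝ) :=
  fun ω i => (Pr[fun ω' => f ω' i | F]) ω

/-- Entrywise conditional expectation of a random matrix. -/
def condMat {Ω : Type*} [MeasurableSpace Ω] (Pr : Measure Ω) {k l : ℕ} (F : MeasurableSpace Ω)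
    (M : Ω → Matrix (Fin k) (Fin l) ℝ) : Ω → Matrix (Fin k) (Fin l) ℝ :=
  fun ω => Matrix.of fun i j => (Pr[fun ω' => M ω' i j | F]) ω

section Dynamics

variable {Ω : Type*} {n m p : ℕ} (S : LQProblem Ω n m p)

/-- The state `x_t` of the closed loop driven by the input process `u`. -/
def state (u : ℕ → Ω → (Fin p → ℝ)) : ℕ → Ω → (Fin n → ℝ)
  | 0 => fun _ => S.x0
  | t + 1 => fun ω => S.A *ᵥ (state u t ω) + S.B *ᵥ (u t ω) + S.w (t + 1) ω

/-- The measured output `y_t`. -/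
def output (u : ℕ → Ω → (Fin p → ℝ)) (t : ℕ) : Ω → (Fin m → ℝ) :=
  fun ω => S.C *ᵥ (S.state u t ω) + S.v t ω

/-- The σ-algebra generated by `z_t = (y_{0:t}, u_{0:t-1})`, the information that is available
when the input `u_t` is chosen. -/
def infoSigma (u : ℕ → Ω → (Fin p → ℝ)) (t : ℕ) : MeasurableSpace Ω :=
  (⨆ s ∈ Set.Iic t, MeasurableSpace.comap (S.output u s) inferInstance) ⊔
    (⨆ s ∈ Set.Iio t, MeasurableSpace.comap (u s) inferInstance)

/-- The σ-algebra `F_t` generated by all observables `y_{0:t}`, `u_{0:t}` up to time `t`. -/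
def obsSigma (u : ℕ → Ω → (Fin p → ℝ)) (t : ℕ) : MeasurableSpace Ω :=
  (⨆ s ∈ Set.Iic t, MeasurableSpace.comap (S.output u s) inferInstance) ⊔
    (⨆ s ∈ Set.Iic t, MeasurableSpace.comap (u s) inferInstance)

/-- `F_{t-1}`, with `F_{-1}` the trivial σ-algebra. -/
def pastSigma (u : ℕ → Ω → (Fin p → ℝ)) : ℕ → MeasurableSpace Ω
  | 0 => ⊥
  | t + 1 => S.obsSigma u t

end Dynamics

section Stochastic

variable {Ω : Type*} [MeasurableSpace Ω] {n m p : ℕ} (S : LQProblem Ω n m p) (Pr : Measure Ω)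

/-- The set `U_0` of admissible policies: each input is a causal function of the available
observables with finite fourth moment (all norms on `ℝ^p` give the same condition).
Only `u_0, …, u_{N-1}` are constrained, and only these enter the problem. -/
def admissible : Set (ℕ → Ω → (Fin p → ℝ)) :=
  {u | ∀ t < S.N, Measurable[S.infoSigma u t] (u t) ∧ MemLp (u t) 4 Pr}

/-- The noise mean `w̄`. -/
def wbar : Fin n → ℝ := fun i => ∫ ω, S.w 1 ω i ∂Pr

/-- The state estimate `E(x_t | F_t)`. -/
def estimate (u : ℕ → Ω → (Fin p → ℝ)) (t : ℕ) : Ω → (Fin n → ℝ) :=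
  condVec Pr (S.obsSigma u t) (S.state u t)

/-- The state prediction `E(x_t | F_{t-1})`. -/
def prediction (u : ℕ → Ω → (Fin p → ℝ)) (t : ℕ) : Ω → (Fin n → ℝ) :=
  condVec Pr (S.pastSigma u t) (S.state u t)

/-- The prediction error `δ_t = x_t - E(x_t | F_{t-1})`. -/
def predErr (u : ℕ → Ω → (Fin p → ℝ)) (t : ℕ) : Ω → (Fin n → ℝ) :=
  fun ω => S.state u t ω - S.prediction Pr u t ω

/-- The refinement error `e_t = E(x_t | F_t) - E(x_t | F_{t-1})`. -/
def refineErr (u : ℕ → Ω → (Fin p → ℝ)) (t : ℕ) : Ω → (Fin n → ℝ) :=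
  fun ω => S.estimate Pr u t ω - S.prediction Pr u t ω

/-- `W_t = E(δ_{t+1} δ_{t+1}' | F_t)`. -/
def condCov (u : ℕ → Ω → (Fin p → ℝ)) (t : ℕ) : Ω → Matrix (Fin n) (Fin n) ℝ :=
  condMat Pr (S.obsSigma u t)
    (fun ω => vecMulVec (S.predErr Pr u (t + 1) ω) (S.predErr Pr u (t + 1) ω))

/-- `m_{3,t} = 2 Q E(δ_{t+1} δ_{t+1}' Q δ_{t+1} | F_t)`. -/
def condThird (u : ℕ → Ω → (Fin p → ℝ)) (t : ℕ) : Ω → (Fin n → ℝ) :=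
  fun ω => (2 : ℝ) • (S.Q *ᵥ condVec Pr (S.obsSigma u t)
    (fun ω' => (S.predErr Pr u (t + 1) ω' ⬝ᵥ (S.Q *ᵥ S.predErr Pr u (t + 1) ω')) •
      S.predErr Pr u (t + 1) ω') ω)

/-- The LQ cost `J(u) = E{x_N' Q x_N + ∑_{t=0}^{N-1} x_t' Q x_t + u_t' R u_t}`. -/
def cost (u : ℕ → Ω → (Fin p → ℝ)) : ℝ :=
  ∫ ω, (S.state u S.N ω ⬝ᵥ (S.Q *ᵥ S.state u S.N ω) +
    ∑ t ∈ Finset.range S.N,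
      (S.state u t ω ⬝ᵥ (S.Q *ᵥ S.state u t ω) + u t ω ⬝ᵥ (S.R *ᵥ u t ω))) ∂Pr

/-- The risk functional
`J_R(u) = E{∑_{t=1}^{N} 4 x̂_t' Q W_{t-1} Q x̂_t + 2 x̂_t' m_{3,t-1}}`,
where `x̂_t` is the prediction (the sum is written with `t + 1` in place of `t`). -/
def risk (u : ℕ → Ω → (Fin p → ℝ)) : ℝ :=
  ∫ ω, (∑ t ∈ Finset.range S.N,
    (4 * (S.prediction Pr u (t + 1) ω ⬝ᵥ
        ((S.Q * S.condCov Pr u t ω * S.Q) *ᵥ S.prediction Pr u (t + 1) ω)) +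
      2 * (S.prediction Pr u (t + 1) ω ⬝ᵥ S.condThird Pr u t ω))) ∂Pr

/-- The feasible policies of the problem: minimize `J(u)` over `u ∈ U_0` with
`J_R(u) ≤ epsBar`. -/
def feasible (epsBar : ℝ) : Set (ℕ → Ω → (Fin p → ℝ)) :=
  {u | u ∈ S.admissible Pr ∧ S.risk Pr u ≤ epsBar}

/-- `u` is an optimal solution of the risk-constrained problem with level `epsBar`. -/
def IsOptimal (epsBar : ℝ) (u : ℕ → Ω → (Fin p → ℝ)) : Prop :=
  u ∈ S.feasible Pr epsBar ∧ ∀ u' ∈ S.feasible Pr epsBar, S.cost Pr u ≤ S.cost Pr u'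

/-- The inflated state penalty `Q_{μ,t} = Q + 4 μ Q W_t Q`. -/
def inflatedPenalty (mu : ℝ) (u : ℕ → Ω → (Fin p → ℝ)) (t : ℕ) :
    Ω → Matrix (Fin n) (Fin n) ℝ :=
  fun ω => S.Q + (4 * mu) • (S.Q * S.condCov Pr u t ω * S.Q)

section Step

variable (mu : ℝ) (u : ℕ → Ω → (Fin p → ℝ)) (t : ℕ)
  (next : (Ω → Matrix (Fin n) (Fin n) ℝ) × (Ω → (Fin n → ℝ)))

/-- `V_t = E(P_{t+1} | F_t) + Q_{μ,t}`, where `next = (P_{t+1}, ζ_{t+1})`. -/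
def stepV : Ω → Matrix (Fin n) (Fin n) ℝ :=
  fun ω => condMat Pr (S.obsSigma u t) next.1 ω + S.inflatedPenalty Pr mu u t ω

/-- `ξ_t = E(P_{t+1} e_{t+1} + ζ_{t+1} | F_t) + μ m_{3,t}`. -/
def stepXi : Ω → (Fin n → ℝ) :=
  fun ω => condVec Pr (S.obsSigma u t)
    (fun ω' => next.1 ω' *ᵥ S.refineErr Pr u (t + 1) ω' + next.2 ω') ω +
      mu • S.condThird Pr u t ω

/-- `K_t = -(B' V_t B + R)⁻¹ B' V_t A`. -/
def stepK : Ω → Matrix (Fin p) (Fin n) ℝ :=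
  fun ω => -((S.Bᵀ * S.stepV Pr mu u t next ω * S.B + S.R)⁻¹ *
    (S.Bᵀ * S.stepV Pr mu u t next ω * S.A))

/-- `l_t = -(B' V_t B + R)⁻¹ B' (ξ_t + V_t w̄)`. -/
def stepL : Ω → (Fin p → ℝ) :=
  fun ω => -((S.Bᵀ * S.stepV Pr mu u t next ω * S.B + S.R)⁻¹ *ᵥ
    (S.Bᵀ *ᵥ (S.stepXi Pr mu u t next ω + S.stepV Pr mu u t next ω *ᵥ S.wbar Pr)))

/-- `P_t = (A + B K_t)' V_t (A + B K_t) + K_t' R K_t`. -/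
def stepP : Ω → Matrix (Fin n) (Fin n) ℝ :=
  fun ω => (S.A + S.B * S.stepK Pr mu u t next ω)ᵀ * S.stepV Pr mu u t next ω *
      (S.A + S.B * S.stepK Pr mu u t next ω) +
    (S.stepK Pr mu u t next ω)ᵀ * S.R * S.stepK Pr mu u t next ω

/-- `ζ_t = (A + B K_t)' (ξ_t + V_t w̄)`. -/
def stepZeta : Ω → (Fin n → ℝ) :=
  fun ω => (S.A + S.B * S.stepK Pr mu u t next ω)ᵀ *ᵥ
    (S.stepXi Pr mu u t next ω + S.stepV Pr mu u t next ω *ᵥ S.wbar Pr)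

end Step

/-- The backward recursion: `backward mu u k` is `(P_{N-k}, ζ_{N-k})` for `k ≤ N`,
started at `P_N = 0`, `ζ_N = 0`. -/
def backward (mu : ℝ) (u : ℕ → Ω → (Fin p → ℝ)) :
    ℕ → (Ω → Matrix (Fin n) (Fin n) ℝ) × (Ω → (Fin n → ℝ))
  | 0 => (fun _ => 0, fun _ => 0)
  | k + 1 => (S.stepP Pr mu u (S.N - (k + 1)) (backward mu u k),
      S.stepZeta Pr mu u (S.N - (k + 1)) (backward mu u k))

/-- The pair `(P_t, ζ_t)`. -/
def costToGo (mu : ℝ) (u : ℕ → Ω → (Fin p → ℝ)) (t : ℕ) :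
    (Ω → Matrix (Fin n) (Fin n) ℝ) × (Ω → (Fin n → ℝ)) :=
  S.backward Pr mu u (S.N - t)

/-- The terminal values `P_N = 0`, `ζ_N = 0`. -/
theorem costToGo_terminal (mu : ℝ) (u : ℕ → Ω → (Fin p → ℝ)) :
    S.costToGo Pr mu u S.N = (fun _ => 0, fun _ => 0) := by
  simp [costToGo, backward]

/-- The recursion for `(P_t, ζ_t)`, `t < N`. -/
theorem costToGo_step (mu : ℝ) (u : ℕ → Ω → (Fin p → ℝ)) (t : ℕ) (ht : t < S.N) :
    S.costToGo Pr mu u t =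
      (S.stepP Pr mu u t (S.costToGo Pr mu u (t + 1)),
        S.stepZeta Pr mu u t (S.costToGo Pr mu u (t + 1))) := by
  obtain ⟨k, hk⟩ : ∃ k, S.N = t + 1 + k := Nat.exists_eq_add_of_le ht
  have h1 : S.N - t = k + 1 := by omega
  have h2 : S.N - (t + 1) = k := by omega
  have h3 : S.N - (k + 1) = t := by omega
  simp only [costToGo, h1, h2, backward, h3]

/-- The gain `K_t`. -/
def gain (mu : ℝ) (u : ℕ → Ω → (Fin p → ℝ)) (t : ℕ) : Ω → Matrix (Fin p) (Fin n) ℝ :=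
  S.stepK Pr mu u t (S.costToGo Pr mu u (t + 1))

/-- The affine term `l_t`. -/
def offset (mu : ℝ) (u : ℕ → Ω → (Fin p → ℝ)) (t : ℕ) : Ω → (Fin p → ℝ) :=
  S.stepL Pr mu u t (S.costToGo Pr mu u (t + 1))

/-- `u` is the risk-aware controller `u*(μ)`: an admissible policy whose closed loop satisfies
`u_t = K_t E(x_t | F_t) + l_t` almost surely for every `t ≤ N - 1`. (Conditional expectations
are defined up to null sets, whence "almost surely".) -/
def IsRiskAwareController (mu : ℝ) (u : ℕ → Ω → (Fin p → ℝ)) : Prop :=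
  u ∈ S.admissible Pr ∧
    ∀ t < S.N, ∀ᵐ ω ∂Pr,
      u t ω = S.gain Pr mu u t ω *ᵥ S.estimate Pr u t ω + S.offset Pr mu u t ω

/-- The multiplier set `{μ ≥ 0 : J_R(u*(μ)) ≤ epsBar}`. -/
def multiplierSet (epsBar : ℝ) (ustar : ℝ → ℕ → Ω → (Fin p → ℝ)) : Set ℝ :=
  {mu | 0 ≤ mu ∧ S.risk Pr (ustar mu) ≤ epsBar}

end Stochastic

end

end LQProblem

open scoped ENNReal

/-! The system is linear, so subtracting the response to past inputs turns the outputs of any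
admissible closed loop into those of the uncontrolled system, and conversely. All admissible
policies therefore generate the same filtration `freeSigma` (there is no dual effect). Admissibility
becomes a linear condition, predictions are affine in the input, and the prediction error, `W_t`,
`m_{3,t}`, `P_t`, `ζ_t`, `K_t`, `l_t` agree almost surely with their values for the zero input
(`costToGo_eq`, `gain_eq`, `offset_eq`). The feedback law thus involves no fixed point: a controller
is built forward in time from the uncontrolled gains. Its moments are finite because `B' V B + R` is
at least as coercive as `R`, which bounds its inverse uniformly.

On this linear space `J` is quadratic with curvature at least that of `R`, and `J_R` is a convex
quadratic (`cost_expansion`, `risk_expansion`). Half the derivative of `J + μ J_R` at `u*(μ)` in a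
direction `d` telescopes: with `f_t` the response to `d`, its time-`t` term is the increment of `E
f_t' (P_t x̂_{t|t} + ζ_t)`, which vanishes at both ends (`slope_eq_zero`). Hence `u*(μ)` minimizes
the Lagrangian, with a gap `c ‖u - u*(μ)‖²` in mean square (`lagrangian_le`).

The rest is abstract (`lagrange_smallest_multiplier`). Comparing the minimizers for two multipliers
shows that the risk decreases in `μ` and bounds the distance of the minimizers by the multiplier gap
times the risk gap. A strictly feasible policy makes large multipliers feasible. Lower
semicontinuity of the risk, approaching `μ*` from above, makes `u*(μ*)` feasible. Approaching `μ*`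
from below, the constraint is violated, so each Lagrangian minimizer costs no more than any feasible
policy; lower semicontinuity of the cost passes this to `u*(μ*)`, and half of the quadratic gap
survives to give uniqueness. -/

/-! ### Abstract Lagrangian duality with one constraint -/

/-- Lagrangian duality for a convex problem with a single constraint: if every Lagrangian
`J + μ Rk` has a strongly unique minimizer `ustar μ` and `J`, `Rk` are lower semicontinuous, then
the smallest multiplier whose minimizer is feasible yields the strongly unique optimizer. -/
theorem lagrange_smallest_multiplier {E : Type*} {adm : Set E} {J Rk : E → ℝ} {D : E → E → ℝ}
    {c : ℝ} (hc : 0 < c) {ustar : ℝ → E}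
    (hJ : ∀ u ∈ adm, 0 ≤ J u)
    (hD : ∀ u ∈ adm, ∀ v ∈ adm, 0 ≤ D u v)
    (hDsymm : ∀ u ∈ adm, ∀ v ∈ adm, D u v = D v u)
    (hDtri : ∀ u ∈ adm, ∀ v ∈ adm, ∀ w ∈ adm, D u w ≤ 2 * D u v + 2 * D v w)
    (hJlsc : ∀ u ∈ adm, ∀ ε > 0, ∃ C, 0 ≤ C ∧ ∀ v ∈ adm, J u - ε - C * D v u ≤ J v)
    (hRlsc : ∀ u ∈ adm, ∀ ε > 0, ∃ C, 0 ≤ C ∧ ∀ v ∈ adm, Rk u - ε - C * D v u ≤ Rk v)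
    (hadm : ∀ μ, 0 ≤ μ → ustar μ ∈ adm)
    (hmin : ∀ μ, 0 ≤ μ → ∀ v ∈ adm,
      J (ustar μ) + μ * Rk (ustar μ) + c * D v (ustar μ) ≤ J v + μ * Rk v)
    {eps : ℝ} (hslater : ∃ u ∈ adm, Rk u < eps) {S : Set ℝ}
    (hS : S = {μ | 0 ≤ μ ∧ Rk (ustar μ) ≤ eps}) :
    S.Nonempty ∧ 0 ≤ sInf S ∧ Rk (ustar (sInf S)) ≤ eps ∧
      ∀ v ∈ adm, Rk v ≤ eps → J (ustar (sInf S)) + c / 2 * D v (ustar (sInf S)) ≤ J v := by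
  have hne : S.Nonempty := by
    obtain ⟨u, hu, hue⟩ := hslater
    have hpos : 0 < eps - Rk u := by linarith
    -- Large enough that `μ * (eps - Rk u)` exceeds `J u`; an infeasible `ustar μ` would then lose
    -- to the strictly feasible `u` in the Lagrangian.
    set μ := J u / (eps - Rk u) + 1 with hμ
    have h0 : 0 ≤ J u / (eps - Rk u) := div_nonneg (hJ u hu) hpos.le
    have hμ0 : 0 < μ := by linarith
    refine ⟨μ, hS ▸ ⟨hμ0.le, ?_⟩⟩
    have h1 := hmin μ hμ0.le u hu
    have h2 := hJ _ (hadm μ hμ0.le)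
    have h3 := mul_nonneg hc.le (hD u hu _ (hadm μ hμ0.le))
    have h4 : μ * (eps - Rk u) = J u + (eps - Rk u) := by rw [hμ]; field_simp
    by_contra! h5
    nlinarith [mul_lt_mul_of_pos_left h5 hμ0]
  have hbdd : BddBelow S := ⟨0, fun μ hμ => by rw [hS] at hμ; exact hμ.1⟩
  have hm0 : 0 ≤ sInf S := le_csInf hne fun μ hμ => by rw [hS] at hμ; exact hμ.1
  set m := sInf S with hm
  -- Sum of the two minimality inequalities, each minimizer tested against the other. It gives both
  -- monotonicity of the risk in the multiplier and a modulus of continuity for the minimizers.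
  have key : ∀ μ ν, 0 ≤ μ → 0 ≤ ν →
      2 * c * D (ustar ν) (ustar μ) ≤ (μ - ν) * (Rk (ustar ν) - Rk (ustar μ)) := by
    intro μ ν hμ hν
    have h1 := hmin μ hμ _ (hadm ν hν)
    have h2 := hmin ν hν _ (hadm μ hμ)
    rw [hDsymm _ (hadm μ hμ) _ (hadm ν hν)] at h2
    nlinarith
  refine ⟨hne, hm0, ?_, fun v hv hve => ?_⟩
  · by_contra! hlt
    obtain ⟨C, hC, hlsc⟩ := hRlsc _ (hadm m hm0) ((Rk (ustar m) - eps) / 2) (by linarith)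
    -- For `ν` within `δ` of `m`, `key` and lower semicontinuity force `2 * c * d ≤ 2 * δ * C * d`
    -- with `d > 0`, whereas `2 * δ * C ≤ c`.
    set δ := c / (2 * C + 1) with hδ
    have hδ0 : 0 < δ := by positivity
    have hδC : δ * (2 * C + 1) = c := by rw [hδ]; field_simp
    obtain ⟨ν, hνS, hν⟩ := exists_lt_of_csInf_lt hne (show sInf S < m + δ by linarith)
    have hmν : m ≤ ν := csInf_le hbdd hνS
    rw [hS] at hνS
    have h1 := hlsc _ (hadm ν hνS.1)
    have h2 := key m ν hm0 hνS.1
    have h3 := hνS.2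
    have hDn := hD _ (hadm ν hνS.1) _ (hadm m hm0)
    set d := D (ustar ν) (ustar m)
    set η := Rk (ustar m) - eps
    have h4 : 2 * c * d ≤ (ν - m) * (η / 2 + C * d) :=
      h2.trans (by nlinarith [mul_nonneg (sub_nonneg.2 hmν) (by linarith :
        (0 : ℝ) ≤ η / 2 + C * d - (Rk (ustar m) - Rk (ustar ν)))])
    have h5 : (ν - m) * (η / 2 + C * d) ≤ δ * (η / 2 + C * d) :=
      mul_le_mul_of_nonneg_right (by linarith) (by simp only [η]; nlinarith [mul_nonneg hC hDn])
    have h6 : η / 2 ≤ C * d := by simp only [η]; linarith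
    have hη : 0 < η := by simp only [η]; linarith
    have h7 : δ * (η / 2 + C * d) ≤ δ * (2 * (C * d)) :=
      mul_le_mul_of_nonneg_left (by linarith) hδ0.le
    have h8 : 2 * c * d ≤ (δ * (2 * C)) * d := by linarith
    have hd : 0 < d := by
      rcases hDn.lt_or_eq with h | h
      · exact h
      · rw [← h] at h6; linarith
    have h9 : 2 * c ≤ δ * (2 * C) := le_of_mul_le_mul_right h8 hd
    linarith
  -- If the infimum is `0`, the Lagrangian is `J` itself; otherwise multipliers slightly below `m`
  -- are available.
  · rcases hm0.eq_or_lt with h0 | hpos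
    · have h1 := hmin m hm0 v hv
      have h2 := mul_nonneg hc.le (hD v hv _ (hadm m hm0))
      rw [← h0] at h1 h2 ⊢
      linarith
    by_contra! hlt
    set η := J (ustar m) + c / 2 * D v (ustar m) - J v with hη
    have hη0 : 0 < η := by linarith
    obtain ⟨C, hC, hlsc⟩ := hJlsc _ (hadm m hm0) (η / 2) (by linarith)
    have hM : 0 ≤ Rk (ustar 0) - Rk (ustar m) := by
      have h1 := key m 0 hm0 le_rfl
      have h2 := mul_nonneg hc.le (hD _ (hadm 0 le_rfl) _ (hadm m hm0))
      by_contra! h3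
      nlinarith [mul_neg_of_pos_of_neg hpos h3]
    set M := Rk (ustar 0) - Rk (ustar m) with hMdef
    -- `M` bounds the risk gap between `m - δ` and `m`, so `key` gives `2 * c * d ≤ δ * M`, and this
    -- choice makes `(C + c) * d` at most `η / 2`. Using `M + 1` in place of `M` makes that bound
    -- strict, which is what contradicts `h10`.
    set δ := min m (c * η / ((C + c) * (M + 1))) with hδ
    have hδ0 : 0 < δ := lt_min hpos (by positivity)
    have hδm : δ ≤ m := min_le_left _ _
    have hδ2 : δ * ((C + c) * (M + 1)) ≤ c * η := by
      rw [← le_div_iff₀ (by positivity)]; exact min_le_right _ _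
    have hν0 : 0 ≤ m - δ := by linarith
    have hνS : eps < Rk (ustar (m - δ)) := by
      by_contra! h
      have : m ≤ m - δ := csInf_le hbdd (by rw [hS]; exact ⟨hν0, h⟩)
      linarith
    have hmono : Rk (ustar (m - δ)) ≤ Rk (ustar 0) := by
      rcases hν0.eq_or_lt with h | h
      · rw [← h]
      have h1 := key (m - δ) 0 hν0 le_rfl
      have h2 := mul_nonneg hc.le (hD _ (hadm 0 le_rfl) _ (hadm _ hν0))
      by_contra! h3
      nlinarith [mul_neg_of_pos_of_neg h (sub_neg.2 h3)]
    have h1 := hmin _ hν0 v hv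
    have h2 := hlsc _ (hadm _ hν0)
    have h3 := hDtri _ hv _ (hadm _ hν0) _ (hadm m hm0)
    have h4 := key m (m - δ) hm0 hν0
    have hDn := hD _ (hadm _ hν0) _ (hadm m hm0)
    set d := D (ustar (m - δ)) (ustar m)
    have h5 : 2 * c * d ≤ δ * (M + 1) := by
      refine h4.trans ?_
      rw [sub_sub_cancel]
      exact mul_le_mul_of_nonneg_left (by linarith) hδ0.le
    -- Below the infimum the minimizer violates the constraint that `v` satisfies, so the multiplier
    -- term has the favourable sign and can be dropped.
    have h6 : J (ustar (m - δ)) + c * D v (ustar (m - δ)) ≤ J v := by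
      nlinarith [mul_nonneg hν0 (by linarith : 0 ≤ Rk (ustar (m - δ)) - Rk v)]
    have h7 : (C + c) * (2 * c * d) ≤ c * η := by
      refine le_trans (mul_le_mul_of_nonneg_left h5 (by positivity)) ?_
      linarith
    have h8 : 2 * ((C + c) * d) ≤ η := by
      refine le_of_mul_le_mul_left ?_ hc
      linarith
    have h9 : c / 2 * D v (ustar m) ≤ c * D v (ustar (m - δ)) + c * d := by
      nlinarith
    have h10 : η / 2 ≤ (C + c) * d := by linarith
    have h11 : (C + c) * d = η / 2 := by linarith
    have h12 : 0 < d := by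
      rcases hDn.lt_or_eq with h | h
      · exact h
      · rw [← h] at h10; linarith
    have h13 : (C + c) * (2 * c * d) ≤ (C + c) * (δ * M) := by
      refine mul_le_mul_of_nonneg_left (h4.trans ?_) (by positivity)
      rw [sub_sub_cancel]
      exact mul_le_mul_of_nonneg_left (by linarith) hδ0.le
    nlinarith [mul_pos (add_pos_of_nonneg_of_pos hC hc) hδ0]

/-! ### Coercive matrices and the algebra of one Riccati step -/

section LinearAlgebra

variable {k l : ℕ}

/-- The constant is the minimum of the quadratic form on the Euclidean unit sphere, which is
compact. The sphere is empty only in dimension `0`, where any constant serves. -/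
theorem Matrix.PosDef.exists_coercive {R : Matrix (Fin k) (Fin k) ℝ} (hR : R.PosDef) :
    ∃ c, 0 < c ∧ ∀ x : Fin k → ℝ, c * (x ⬝ᵥ x) ≤ x ⬝ᵥ (R *ᵥ x) := by
  set K : Set (Fin k → ℝ) := {x | x ⬝ᵥ x = 1} with hK
  have hdot : Continuous fun x : Fin k → ℝ => x ⬝ᵥ x := continuous_id.dotProduct continuous_id
  have hcont : Continuous fun x : Fin k → ℝ => x ⬝ᵥ (R *ᵥ x) :=
    continuous_id.dotProduct (continuous_const.matrix_mulVec continuous_id)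
  have hcpt : IsCompact K := by
    refine Metric.isCompact_of_isClosed_isBounded (isClosed_eq hdot continuous_const) ?_
    refine (Metric.isBounded_closedBall (x := (0 : Fin k → ℝ)) (r := 1)).subset fun x hx => ?_
    rw [mem_closedBall_zero_iff, pi_norm_le_iff_of_nonneg zero_le_one]
    intro i
    have h1 : x i * x i ≤ x ⬝ᵥ x :=
      Finset.single_le_sum (f := fun j => x j * x j) (fun j _ => mul_self_nonneg _)
        (Finset.mem_univ i)
    rw [hx] at h1
    rw [Real.norm_eq_abs, ← abs_one, ← sq_le_sq, one_pow, pow_two]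
    exact h1
  have hnorm : ∀ x : Fin k → ℝ, x ≠ 0 → (Real.sqrt (x ⬝ᵥ x))⁻¹ • x ∈ K := by
    intro x hx
    have hpos : 0 < x ⬝ᵥ x := by
      simpa using (dotProduct_star_self_pos_iff (v := x)).2 hx
    simp only [hK, Set.mem_ofPred_eq, smul_dotProduct, dotProduct_smul, smul_eq_mul]
    rw [← mul_assoc, ← mul_inv, Real.mul_self_sqrt hpos.le, inv_mul_cancel₀ hpos.ne']
  rcases K.eq_empty_or_nonempty with he | hne
  · refine ⟨1, one_pos, fun x => ?_⟩
    have : x = 0 := by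
      by_contra h
      exact (he ▸ hnorm x h : _ ∈ (∅ : Set (Fin k → ℝ)))
    simp [this]
  · obtain ⟨z, hz, hmin⟩ := hcpt.exists_isMinOn hne hcont.continuousOn
    have hz0 : z ≠ 0 := by
      rintro rfl
      simp [hK] at hz
    refine ⟨z ⬝ᵥ (R *ᵥ z), by simpa using hR.dotProduct_mulVec_pos hz0, fun x => ?_⟩
    by_cases hx : x = 0
    · simp [hx]
    have hpos : 0 < x ⬝ᵥ x := by
      simpa using (dotProduct_star_self_pos_iff (v := x)).2 hx
    have h1 : z ⬝ᵥ (R *ᵥ z) ≤ _ := hmin (hnorm x hx)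
    simp only [mulVec_smul, smul_dotProduct, dotProduct_smul, smul_eq_mul] at h1
    rw [← mul_assoc, ← mul_inv, Real.mul_self_sqrt hpos.le, inv_mul_eq_div,
      le_div_iff₀ hpos] at h1
    exact h1

theorem Matrix.isUnit_of_coercive {M : Matrix (Fin k) (Fin k) ℝ} {c : ℝ} (hc : 0 < c)
    (hM : ∀ x : Fin k → ℝ, c * (x ⬝ᵥ x) ≤ x ⬝ᵥ (M *ᵥ x)) : IsUnit M := by
  rw [← mulVec_injective_iff_isUnit]
  refine (injective_iff_map_eq_zero M.mulVecLin).2 fun x hx => ?_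
  have h := hM x
  rw [← mulVecLin_apply, hx, dotProduct_zero] at h
  have h2 : x ⬝ᵥ x = 0 := le_antisymm (by nlinarith) (by
    simpa using dotProduct_star_self_nonneg x)
  exact dotProduct_self_eq_zero.1 h2

/-- Column `j` of the inverse, `x`, solves `M x = e_j`, so coercivity reads `c |x|² ≤ x_j`, whence
`|x| ≤ 1 / c`. The bound depends on `c` alone, so a random `M` may be unbounded. -/
theorem Matrix.abs_inv_apply_le_of_coercive {M : Matrix (Fin k) (Fin k) ℝ} {c : ℝ} (hc : 0 < c)
    (hM : ∀ x : Fin k → ℝ, c * (x ⬝ᵥ x) ≤ x ⬝ᵥ (M *ᵥ x)) (i j : Fin k) :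
    |M⁻¹ i j| ≤ c⁻¹ := by
  have hu : IsUnit M.det := (isUnit_iff_isUnit_det M).1 (isUnit_of_coercive hc hM)
  set x := M⁻¹ *ᵥ Pi.single j 1 with hx
  have hxi : ∀ i, x i = M⁻¹ i j := fun i => by simp [hx]
  have hMx : M *ᵥ x = Pi.single j 1 := by
    rw [hx, mulVec_mulVec, mul_nonsing_inv _ hu, one_mulVec]
  have h1 := hM x
  rw [hMx, dotProduct_single_one] at h1
  have h2 : ∀ i, x i * x i ≤ x ⬝ᵥ x := fun i =>
    Finset.single_le_sum (f := fun j => x j * x j) (fun j _ => mul_self_nonneg _)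
      (Finset.mem_univ i)
  have h3 : 0 ≤ x ⬝ᵥ x := (mul_self_nonneg _).trans (h2 i)
  have hc' : c * c⁻¹ = 1 := mul_inv_cancel₀ hc.ne'
  have hci : 0 < c⁻¹ := inv_pos.2 hc
  have hxj : x j ≤ c⁻¹ := by
    by_contra! h
    nlinarith [h2 j, mul_lt_mul_of_pos_left h hc, mul_le_mul_of_nonneg_left (h2 j) hc.le]
  have h4 : x ⬝ᵥ x ≤ c⁻¹ * c⁻¹ := by
    have : c * (x ⬝ᵥ x) ≤ c * (c⁻¹ * c⁻¹) := by rw [← mul_assoc, hc', one_mul]; linarith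
    exact le_of_mul_le_mul_left this hc
  rw [← hxi i]
  exact abs_le_of_sq_le_sq (by nlinarith [h2 i]) hci.le

theorem measurable_det {Ω : Type*} {G : MeasurableSpace Ω} {M : Ω → Matrix (Fin k) (Fin k) ℝ}
    (hM : ∀ i j, Measurable fun ω => M ω i j) : Measurable fun ω => (M ω).det := by
  simp only [det_apply']
  exact Finset.measurable_fun_sum _ fun σ _ =>
    (Finset.measurable_fun_prod _ fun i _ => hM _ _).const_mul _

/-- Adjugate over determinant. No invertibility is needed, since real inversion, with value `0` at
`0`, is measurable everywhere. -/
theorem measurable_matrix_inv {Ω : Type*} {G : MeasurableSpace Ω}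
    {M : Ω → Matrix (Fin k) (Fin k) ℝ} (hM : ∀ i j, Measurable fun ω => M ω i j) (i j : Fin k) :
    Measurable fun ω => (M ω)⁻¹ i j := by
  simp only [inv_def, Matrix.smul_apply, smul_eq_mul, Ring.inverse_eq_inv', adjugate_apply]
  refine (measurable_det hM).inv.mul (measurable_det fun a b => ?_)
  simp only [updateRow_apply]
  by_cases h : a = j
  · simp only [h, if_true]; exact measurable_const
  · simp only [h, if_false]; exact hM a b

/-- One step of the costate recursion, in algebraic form. -/
theorem costate_step {n p : ℕ} {A V P : Matrix (Fin n) (Fin n) ℝ} {B : Matrix (Fin n) (Fin p) ℝ}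
    {R : Matrix (Fin p) (Fin p) ℝ} {K : Matrix (Fin p) (Fin n) ℝ} {b ζ x ξ w f : Fin n → ℝ}
    {l u d : Fin p → ℝ} (hV : Vᵀ = V) (hR : Rᵀ = R) (hM : IsUnit (Bᵀ * V * B + R))
    (hK : K = -((Bᵀ * V * B + R)⁻¹ * (Bᵀ * V * A))) (hb : b = ξ + V *ᵥ w)
    (hl : l = -((Bᵀ * V * B + R)⁻¹ *ᵥ (Bᵀ *ᵥ b)))
    (hP : P = (A + B * K)ᵀ * V * (A + B * K) + Kᵀ * R * K) (hζ : ζ = (A + B * K)ᵀ *ᵥ b)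
    (hu : u = K *ᵥ x + l) :
    f ⬝ᵥ (P *ᵥ x + ζ) =
      (A *ᵥ f + B *ᵥ d) ⬝ᵥ (V *ᵥ (A *ᵥ x + B *ᵥ u + w) + ξ) + d ⬝ᵥ (R *ᵥ u) := by
  have hdet := (isUnit_iff_isUnit_det _).1 hM
  set M := Bᵀ * V * B + R with hMdef
  have hMK : M * K = -(Bᵀ * V * A) := by
    rw [hK, Matrix.mul_neg, mul_nonsing_inv_cancel_left _ _ hdet]
  have hMl : M *ᵥ l = -(Bᵀ *ᵥ b) := by
    rw [hl, mulVec_neg, mulVec_mulVec, mul_nonsing_inv _ hdet, one_mulVec]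
  have hMT : Mᵀ = M := by
    simp [hMdef, transpose_mul, hV, hR, Matrix.mul_assoc]
  have hKM : Kᵀ * M = -(Aᵀ * V * B) := by
    have := congrArg Matrix.transpose hMK
    simpa [transpose_mul, hMT, hV, Matrix.mul_assoc] using this
  have hMu : M *ᵥ u = -((Bᵀ * V * A) *ᵥ x) - Bᵀ *ᵥ b := by
    rw [hu, mulVec_add, mulVec_mulVec, hMK, hMl, neg_mulVec, sub_eq_add_neg]
  have hg : V *ᵥ (A *ᵥ x + B *ᵥ u + w) + ξ = (V * A) *ᵥ x + (V * B) *ᵥ u + b := by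
    rw [hb, mulVec_add, mulVec_add, mulVec_mulVec, mulVec_mulVec]; abel
  -- The feedback law is the first-order condition in the input; it is what makes the direction `d`
  -- cancel on the right-hand side of the goal.
  have h1 : Bᵀ *ᵥ ((V * A) *ᵥ x + (V * B) *ᵥ u + b) + R *ᵥ u = 0 := by
    have h2 : M *ᵥ u = (Bᵀ * V * B) *ᵥ u + R *ᵥ u := by rw [hMdef, add_mulVec]
    rw [h2] at hMu
    rw [mulVec_add, mulVec_add, mulVec_mulVec, mulVec_mulVec, ← Matrix.mul_assoc,
      ← Matrix.mul_assoc]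
    have h3 : R *ᵥ u = -((Bᵀ * V * A) *ᵥ x) - Bᵀ *ᵥ b - (Bᵀ * V * B) *ᵥ u := by
      rw [← hMu]; abel
    rw [h3]; abel
  have h2 : P *ᵥ x + ζ = Aᵀ *ᵥ ((V * A) *ᵥ x + (V * B) *ᵥ u + b) := by
    -- In the symmetric form of the Riccati step, the terms with `Kᵀ` on the left vanish by the
    -- normal equation `hMK`.
    have e1 : P = Aᵀ * V * (A + B * K) := by
      have : P = Aᵀ * V * (A + B * K) + Kᵀ * (Bᵀ * V * A + M * K) := by
        rw [hP, hMdef, transpose_add, transpose_mul]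
        simp only [Matrix.add_mul, Matrix.mul_add, Matrix.mul_assoc]; abel
      rw [this, hMK, add_neg_cancel, Matrix.mul_zero, add_zero]
    have e2 : (Kᵀ * Bᵀ) *ᵥ b = (Aᵀ * V * B) *ᵥ l := by
      have : Bᵀ *ᵥ b = -(M *ᵥ l) := by rw [hMl, neg_neg]
      rw [← mulVec_mulVec, this, mulVec_neg, mulVec_mulVec, hKM, neg_mulVec, neg_neg]
    rw [e1, hζ, transpose_add, transpose_mul, add_mulVec, e2, hu]
    simp only [mulVec_add, mulVec_mulVec, Matrix.mul_add, add_mulVec, Matrix.mul_assoc]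
    abel
  rw [hg, h2, add_dotProduct]
  have h3 : d ⬝ᵥ (R *ᵥ u) = -((B *ᵥ d) ⬝ᵥ ((V * A) *ᵥ x + (V * B) *ᵥ u + b)) := by
    rw [eq_neg_of_add_eq_zero_right h1]
    rw [dotProduct_neg, mulVec_transpose, dotProduct_comm d, ← dotProduct_mulVec, dotProduct_comm]
  rw [h3, mulVec_transpose, dotProduct_comm f, ← dotProduct_mulVec, dotProduct_comm]
  ring

theorem Matrix.PosSemidef.coercive_conj_add {n p : ℕ} {V : Matrix (Fin n) (Fin n) ℝ}
    (hV : V.PosSemidef) (B : Matrix (Fin n) (Fin p) ℝ) {R : Matrix (Fin p) (Fin p) ℝ} {c : ℝ}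
    (hR : ∀ x : Fin p → ℝ, c * (x ⬝ᵥ x) ≤ x ⬝ᵥ (R *ᵥ x)) (x : Fin p → ℝ) :
    c * (x ⬝ᵥ x) ≤ x ⬝ᵥ ((Bᵀ * V * B + R) *ᵥ x) := by
  have h := (hV.conjTranspose_mul_mul_same B).dotProduct_mulVec_nonneg x
  simp only [star_trivial, conjTranspose_eq_transpose_of_trivial] at h
  rw [add_mulVec, dotProduct_add]
  linarith [hR x]

end LinearAlgebra

namespace LQProblem

/-! ### Random variables with all moments -/

section Moments

variable {Ω : Type*} {G : MeasurableSpace Ω} [m0 : MeasurableSpace Ω] {Pr : Measure Ω}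

/-- All moments of the real random variable `f` are finite. -/
def AllMoments (Pr : Measure Ω) (f : Ω → ℝ) : Prop := ∀ q : ℕ, MemLp f q Pr

namespace AllMoments

variable {f g : Ω → ℝ}

theorem memLp_four (hf : AllMoments Pr f) : MemLp f 4 Pr := by exact_mod_cast hf 4

theorem memLp_two (hf : AllMoments Pr f) : MemLp f 2 Pr := by exact_mod_cast hf 2

theorem integrable (hf : AllMoments Pr f) : Integrable f Pr :=
  memLp_one_iff_integrable.1 (by exact_mod_cast hf 1)

theorem congr (hf : AllMoments Pr f) (h : f =ᵐ[Pr] g) : AllMoments Pr g :=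
  fun q => (hf q).ae_eq h

theorem add (hf : AllMoments Pr f) (hg : AllMoments Pr g) :
    AllMoments Pr fun ω => f ω + g ω := fun q => (hf q).add (hg q)

theorem sub (hf : AllMoments Pr f) (hg : AllMoments Pr g) :
    AllMoments Pr fun ω => f ω - g ω := fun q => (hf q).sub (hg q)

theorem neg (hf : AllMoments Pr f) : AllMoments Pr fun ω => -f ω := fun q => (hf q).neg

theorem const_mul (hf : AllMoments Pr f) (c : ℝ) : AllMoments Pr fun ω => c * f ω :=
  fun q => (hf q).const_mul c

theorem sum {ι : Type*} {s : Finset ι} {F : ι → Ω → ℝ} (hF : ∀ i, AllMoments Pr (F i)) :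
    AllMoments Pr fun ω => ∑ i ∈ s, F i ω := fun q => memLp_finsetSum s fun i _ => hF i q

/-- Hölder: the `q`-th moment of a product costs moments of order `2q` of the factors. The recursion
multiplies at every step, so a class with a fixed exponent would not be preserved. -/
theorem mul (hf : AllMoments Pr f) (hg : AllMoments Pr g) :
    AllMoments Pr fun ω => f ω * g ω := by
  intro q
  have h1 := hf (2 * q)
  have h2 := hg (2 * q)
  push_cast at h1 h2
  have : ENNReal.HolderTriple (2 * q) (2 * q) q := ⟨by
    rw [ENNReal.mul_inv (by simp) (by simp), ← add_mul, ENNReal.inv_two_add_inv_two, one_mul]⟩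
  exact MemLp.mul' h2 h1

theorem const [IsProbabilityMeasure Pr] (c : ℝ) : AllMoments Pr fun _ => c := fun _ => memLp_const c

theorem of_bound [IsProbabilityMeasure Pr] (hf : AEStronglyMeasurable f Pr) (C : ℝ) (h : ∀ᵐ ω ∂Pr, |f ω| ≤ C) :
    AllMoments Pr f := fun _ => MemLp.of_bound hf C h

theorem condExp [IsProbabilityMeasure Pr] (hf : AllMoments Pr f) : AllMoments Pr (Pr[f | G]) := by
  intro q
  -- Conditional expectation preserves `L^q` for `q ≥ 1`; passing through `q + 1` covers `q = 0`.
  have h : MemLp (Pr[f | G]) ((q + 1 : ℕ) : ℝ≥0∞) Pr :=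
    MemLp.condExp (by simp) (hf (q + 1))
  exact h.mono_exponent (by exact_mod_cast q.le_succ)

variable {k l r : ℕ}

theorem matrix_mul {M : Ω → Matrix (Fin k) (Fin l) ℝ} {N : Ω → Matrix (Fin l) (Fin r) ℝ}
    (hM : ∀ i j, AllMoments Pr fun ω => M ω i j) (hN : ∀ i j, AllMoments Pr fun ω => N ω i j)
    (i : Fin k) (j : Fin r) : AllMoments Pr fun ω => (M ω * N ω) i j := by
  simp only [mul_apply]
  exact sum fun a => (hM i a).mul (hN a j)

theorem mulVec {M : Ω → Matrix (Fin k) (Fin l) ℝ} {x : Ω → Fin l → ℝ}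
    (hM : ∀ i j, AllMoments Pr fun ω => M ω i j) (hx : ∀ i, AllMoments Pr fun ω => x ω i)
    (i : Fin k) : AllMoments Pr fun ω => (M ω *ᵥ x ω) i := by
  simp only [Matrix.mulVec, dotProduct]
  exact sum fun a => (hM i a).mul (hx a)

end AllMoments

section FourthMoment

variable {k l : ℕ}

theorem memLp_const_mulVec {q : ℝ≥0∞} (M : Matrix (Fin k) (Fin l) ℝ) {x : Ω → Fin l → ℝ}
    (hx : ∀ i, MemLp (fun ω => x ω i) q Pr) (i : Fin k) :
    MemLp (fun ω => (M *ᵥ x ω) i) q Pr := by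
  simp only [Matrix.mulVec, dotProduct]
  exact memLp_finsetSum _ fun a _ => (hx a).const_mul _

theorem memLp_two_mul_of_four {f g : Ω → ℝ} (hf : MemLp f 4 Pr) (hg : MemLp g 4 Pr) :
    MemLp (fun ω => f ω * g ω) 2 Pr := by
  have : ENNReal.HolderTriple 4 4 2 := ⟨by
    rw [show (4 : ℝ≥0∞) = 2 * 2 by norm_num, ENNReal.mul_inv (by simp) (by simp), ← add_mul,
      ENNReal.inv_two_add_inv_two, one_mul]⟩
  exact MemLp.mul' hg hf

theorem memLp_two_of_four [IsProbabilityMeasure Pr] {f : Ω → ℝ} (hf : MemLp f 4 Pr) : MemLp f 2 Pr :=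
  hf.mono_exponent (by norm_num)

theorem memLp_two_mulVec {M : Ω → Matrix (Fin k) (Fin l) ℝ} {x : Ω → Fin l → ℝ}
    (hM : ∀ i j, AllMoments Pr fun ω => M ω i j) (hx : ∀ i, MemLp (fun ω => x ω i) 4 Pr)
    (i : Fin k) : MemLp (fun ω => (M ω *ᵥ x ω) i) 2 Pr := by
  simp only [Matrix.mulVec, dotProduct]
  exact memLp_finsetSum _ fun a _ => memLp_two_mul_of_four (hM i a).memLp_four (hx a)

theorem integrable_mul_of_two {f g : Ω → ℝ} (hf : MemLp f 2 Pr) (hg : MemLp g 2 Pr) :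
    Integrable (fun ω => f ω * g ω) Pr := hf.integrable_mul hg

theorem integrable_dotProduct {x y : Ω → Fin k → ℝ} (hx : ∀ i, MemLp (fun ω => x ω i) 2 Pr)
    (hy : ∀ i, MemLp (fun ω => y ω i) 2 Pr) : Integrable (fun ω => x ω ⬝ᵥ y ω) Pr := by
  simp only [dotProduct]
  exact integrable_finsetSum _ fun i _ => integrable_mul_of_two (hx i) (hy i)

end FourthMoment

/-! ### Conditional expectations of vectors and matrices -/

section Conditioning

variable {k l : ℕ}

theorem integral_mul_condExp [IsProbabilityMeasure Pr] (hG : G ≤ m0) {f g : Ω → ℝ}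
    (hf : Measurable[G] f)
    (hfg : Integrable (fun ω => f ω * g ω) Pr) (hg : Integrable g Pr) :
    ∫ ω, f ω * g ω ∂Pr = ∫ ω, f ω * (Pr[g | G]) ω ∂Pr := by
  rw [← integral_condExp hG]
  exact integral_congr_ae
    (condExp_mul_of_stronglyMeasurable_left hf.stronglyMeasurable hfg hg)

theorem integral_dotProduct_condVec [IsProbabilityMeasure Pr] (hG : G ≤ m0) {x y : Ω → Fin k → ℝ}
    (hxm : ∀ i, Measurable[G] fun ω => x ω i)
    (hx : ∀ i, MemLp (fun ω => x ω i) 2 Pr) (hy : ∀ i, MemLp (fun ω => y ω i) 2 Pr) :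
    ∫ ω, x ω ⬝ᵥ y ω ∂Pr = ∫ ω, x ω ⬝ᵥ condVec Pr G y ω ∂Pr := by
  simp only [dotProduct, condVec]
  rw [integral_finsetSum _ fun i _ => integrable_mul_of_two (hx i) (hy i),
    integral_finsetSum _ fun i _ => integrable_mul_of_two (hx i) ((hy i).condExp one_le_two)]
  exact Finset.sum_congr rfl fun i _ => integral_mul_condExp hG (hxm i)
    (integrable_mul_of_two (hx i) (hy i)) ((hy i).integrable one_le_two)

/-- Pull-out property, entry by entry. The fourth moments of `x` and `y` put the products `x_i y_j`
in `L²`, so that they pair with the entries of `M`. -/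
theorem integral_dotProduct_condMat_mulVec [IsProbabilityMeasure Pr] (hG : G ≤ m0)
    {x : Ω → Fin k → ℝ} {y : Ω → Fin l → ℝ}
    {M : Ω → Matrix (Fin k) (Fin l) ℝ}
    (hxm : ∀ i, Measurable[G] fun ω => x ω i) (hym : ∀ i, Measurable[G] fun ω => y ω i)
    (hx : ∀ i, MemLp (fun ω => x ω i) 4 Pr) (hy : ∀ i, MemLp (fun ω => y ω i) 4 Pr)
    (hM : ∀ i j, MemLp (fun ω => M ω i j) 2 Pr) :
    ∫ ω, x ω ⬝ᵥ (M ω *ᵥ y ω) ∂Pr = ∫ ω, x ω ⬝ᵥ (condMat Pr G M ω *ᵥ y ω) ∂Pr := by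
  have e : ∀ N : Ω → Matrix (Fin k) (Fin l) ℝ, ∀ ω,
      x ω ⬝ᵥ (N ω *ᵥ y ω) = ∑ i, ∑ j, (x ω i * y ω j) * N ω i j := by
    intro N ω
    simp only [dotProduct, Matrix.mulVec, Finset.mul_sum]
    exact Finset.sum_congr rfl fun i _ => Finset.sum_congr rfl fun j _ => by ring
  have hxy : ∀ i j, MemLp (fun ω => x ω i * y ω j) 2 Pr := fun i j =>
    memLp_two_mul_of_four (hx i) (hy j)
  have hint : ∀ N : Ω → Matrix (Fin k) (Fin l) ℝ, (∀ i j, MemLp (fun ω => N ω i j) 2 Pr) →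
      ∫ ω, x ω ⬝ᵥ (N ω *ᵥ y ω) ∂Pr = ∑ i, ∑ j, ∫ ω, (x ω i * y ω j) * N ω i j ∂Pr := by
    intro N hN
    simp only [e]
    rw [integral_finsetSum _ fun i _ => integrable_finsetSum _ fun j _ =>
      integrable_mul_of_two (hxy i j) (hN i j)]
    exact Finset.sum_congr rfl fun i _ =>
      integral_finsetSum _ fun j _ => integrable_mul_of_two (hxy i j) (hN i j)
  rw [hint M hM, hint (condMat Pr G M) fun i j => (hM i j).condExp one_le_two]
  exact Finset.sum_congr rfl fun i _ => Finset.sum_congr rfl fun j _ =>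
    integral_mul_condExp hG ((hxm i).mul (hym j)) (integrable_mul_of_two (hxy i j) (hM i j))
      ((hM i j).integrable one_le_two)

theorem condMat_congr {M N : Ω → Matrix (Fin k) (Fin l) ℝ} (h : M =ᵐ[Pr] N) :
    condMat Pr G M =ᵐ[Pr] condMat Pr G N := by
  have : ∀ i j, Pr[fun ω => M ω i j | G] =ᵐ[Pr] Pr[fun ω => N ω i j | G] := fun i j =>
    condExp_congr_ae (h.mono fun ω hω => by simp only [hω])
  filter_upwards [ae_all_iff.2 fun i => ae_all_iff.2 (this i)] with ω hω
  ext i j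
  exact hω i j

theorem condVec_congr {x y : Ω → Fin k → ℝ} (h : x =ᵐ[Pr] y) :
    condVec Pr G x =ᵐ[Pr] condVec Pr G y := by
  have : ∀ i, Pr[fun ω => x ω i | G] =ᵐ[Pr] Pr[fun ω => y ω i | G] := fun i =>
    condExp_congr_ae (h.mono fun ω hω => by simp only [hω])
  filter_upwards [ae_all_iff.2 this] with ω hω
  ext i
  exact hω i

theorem condVec_add {x y : Ω → Fin k → ℝ} (hx : ∀ i, Integrable (fun ω => x ω i) Pr)
    (hy : ∀ i, Integrable (fun ω => y ω i) Pr) :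
    condVec Pr G (fun ω => x ω + y ω) =ᵐ[Pr]
      fun ω => condVec Pr G x ω + condVec Pr G y ω := by
  filter_upwards [ae_all_iff.2 fun i => condExp_add (hx i) (hy i) G] with ω hω
  ext i
  exact hω i

theorem condVec_of_measurable [IsProbabilityMeasure Pr] (hG : G ≤ m0) {x : Ω → Fin k → ℝ}
    (hxm : ∀ i, Measurable[G] fun ω => x ω i) (hx : ∀ i, Integrable (fun ω => x ω i) Pr) :
    condVec Pr G x = x := by
  ext ω i
  exact congrFun (condExp_of_stronglyMeasurable hG (hxm i).stronglyMeasurable (hx i)) ω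

theorem condVec_const_mulVec (M : Matrix (Fin k) (Fin l) ℝ) {x : Ω → Fin l → ℝ}
    (hx : ∀ i, Integrable (fun ω => x ω i) Pr) :
    condVec Pr G (fun ω => M *ᵥ x ω) =ᵐ[Pr] fun ω => M *ᵥ condVec Pr G x ω := by
  have h1 : ∀ i, Pr[fun ω => (M *ᵥ x ω) i | G] =ᵐ[Pr]
      fun ω => (M *ᵥ condVec Pr G x ω) i := by
    intro i
    have h2 := condExp_finsetSum (μ := Pr) (s := Finset.univ)
      (f := fun j ω => M i j * x ω j) (fun j _ => (hx j).const_mul _) G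
    have h3 : ∀ j, Pr[fun ω => M i j * x ω j | G] =ᵐ[Pr]
        fun ω => M i j * (Pr[fun ω => x ω j | G]) ω := fun j =>
      condExp_smul (M i j) (fun ω => x ω j) G
    have e : (fun ω => (M *ᵥ x ω) i) = ∑ j, fun ω => M i j * x ω j := by
      ext ω
      simp [Matrix.mulVec, dotProduct]
    rw [e]
    filter_upwards [h2, ae_all_iff.2 h3] with ω h2 h3
    rw [h2, Finset.sum_apply]
    exact Finset.sum_congr rfl fun j _ => h3 j
  filter_upwards [ae_all_iff.2 h1] with ω hω
  ext i
  exact hω i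

/-- Each fixed test vector gives its own null set, so only the countably many rational ones are
tested; density and continuity of the quadratic form do the rest. -/
theorem condMat_posSemidef {M : Ω → Matrix (Fin k) (Fin k) ℝ}
    (hM : ∀ᵐ ω ∂Pr, (M ω).PosSemidef) (hint : ∀ i j, Integrable (fun ω => M ω i j) Pr) :
    ∀ᵐ ω ∂Pr, (condMat Pr G M ω).PosSemidef := by
  have hsymm : ∀ i j, ∀ᵐ ω ∂Pr, condMat Pr G M ω i j = condMat Pr G M ω j i := fun i j =>
    condExp_congr_ae (hM.mono fun ω hω => by simpa using (hω.1.apply i j).symm)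
  have hquad : ∀ x : Fin k → ℚ, ∀ᵐ ω ∂Pr,
      0 ≤ (fun i => (x i : ℝ)) ⬝ᵥ (condMat Pr G M ω *ᵥ fun i => (x i : ℝ)) := by
    intro x
    set y : Fin k → ℝ := fun i => (x i : ℝ)
    have h1 : ∀ i j, Pr[fun ω => (y i * y j) * M ω i j | G] =ᵐ[Pr]
        fun ω => (y i * y j) * condMat Pr G M ω i j := fun i j =>
      condExp_smul (y i * y j) (fun ω => M ω i j) G
    have h2 := condExp_finsetSum (μ := Pr) (s := Finset.univ)
      (f := fun (ij : Fin k × Fin k) ω => (y ij.1 * y ij.2) * M ω ij.1 ij.2)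
      (fun j _ => (hint _ _).const_mul _) G
    have e : ∀ N : Matrix (Fin k) (Fin k) ℝ,
        y ⬝ᵥ (N *ᵥ y) = ∑ ij : Fin k × Fin k, (y ij.1 * y ij.2) * N ij.1 ij.2 := by
      intro N
      rw [Fintype.sum_prod_type]
      simp only [dotProduct, Matrix.mulVec, Finset.mul_sum]
      exact Finset.sum_congr rfl fun i _ => Finset.sum_congr rfl fun j _ => by ring
    have h3 : 0 ≤ᵐ[Pr] Pr[∑ ij : Fin k × Fin k,
        (fun ω => (y ij.1 * y ij.2) * M ω ij.1 ij.2) | G] := by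
      refine condExp_nonneg (hM.mono fun ω hω => ?_)
      have := hω.dotProduct_mulVec_nonneg y
      rw [star_trivial, e] at this
      simpa using this
    filter_upwards [h2, h3, ae_all_iff.2 fun i => ae_all_iff.2 (h1 i)] with ω h2 h3 h1
    rw [e]
    rw [h2, Finset.sum_apply] at h3
    simp only [h1] at h3
    exact h3
  filter_upwards [ae_all_iff.2 fun i => ae_all_iff.2 (hsymm i), ae_all_iff.2 hquad] with ω h1 h2
  refine .of_dotProduct_mulVec_nonneg (by ext i j; simpa using h1 j i) fun x => ?_
  rw [star_trivial]
  have hd : DenseRange fun (x : Fin k → ℚ) (i : Fin k) => (x i : ℝ) :=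
    DenseRange.piMap fun _ => Rat.denseRange_cast
  have hcont : Continuous fun x : Fin k → ℝ => x ⬝ᵥ (condMat Pr G M ω *ᵥ x) :=
    continuous_id.dotProduct (continuous_const.matrix_mulVec continuous_id)
  exact hd.induction_on (p := fun x => 0 ≤ x ⬝ᵥ (condMat Pr G M ω *ᵥ x)) x
    (isClosed_le continuous_const hcont) h2

end Conditioning

/-- A continuous linear functional on `L²` is bounded below by `-ε - C ‖·‖²`. -/
theorem exists_lower_bound_integral_dotProduct {k : ℕ} {y : Ω → Fin k → ℝ}
    (hy : ∀ i, MemLp (fun ω => y ω i) 2 Pr) {ε : ℝ} (hε : 0 < ε) :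
    ∃ C, 0 ≤ C ∧ ∀ x : Ω → Fin k → ℝ, (∀ i, MemLp (fun ω => x ω i) 2 Pr) →
      -ε - C * ∫ ω, x ω ⬝ᵥ x ω ∂Pr ≤ ∫ ω, x ω ⬝ᵥ y ω ∂Pr := by
  set Y := ∫ ω, y ω ⬝ᵥ y ω ∂Pr with hY
  have hY0 : 0 ≤ Y := integral_nonneg fun ω => by
    simpa using dotProduct_star_self_nonneg (y ω)
  -- Weight in Young's inequality `-s |y|² - |x|² / s ≤ x · y`, chosen so that `s * Y ≤ ε`; the `+
  -- 1` allows `Y = 0`.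
  set s := ε / (Y + 1) with hs
  have hs0 : 0 < s := by positivity
  have hsY : s * Y ≤ ε := by
    have : s * (Y + 1) = ε := by rw [hs]; field_simp
    linarith
  refine ⟨s⁻¹, by positivity, fun x hx => ?_⟩
  have h1 : ∀ ω, -(s * (y ω ⬝ᵥ y ω)) - s⁻¹ * (x ω ⬝ᵥ x ω) ≤ x ω ⬝ᵥ y ω := by
    intro ω
    simp only [dotProduct, Finset.mul_sum, ← Finset.sum_neg_distrib, ← Finset.sum_sub_distrib]
    refine Finset.sum_le_sum fun i _ => ?_
    have h2 : s * s⁻¹ = 1 := mul_inv_cancel₀ hs0.ne'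
    have h3 : 0 ≤ s * (y ω i + s⁻¹ * x ω i) ^ 2 := by positivity
    have h4 : s * (y ω i + s⁻¹ * x ω i) ^ 2 =
        s * (y ω i * y ω i) + 2 * (x ω i * y ω i) + s⁻¹ * (x ω i * x ω i) := by
      linear_combination (2 * y ω i * x ω i + s⁻¹ * x ω i ^ 2) * h2
    have h5 : 0 ≤ s * (y ω i * y ω i) := by nlinarith [mul_self_nonneg (y ω i)]
    have h6 : 0 ≤ s⁻¹ * (x ω i * x ω i) :=
      mul_nonneg (inv_pos.2 hs0).le (mul_self_nonneg _)
    linarith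
  have iy := (integrable_dotProduct hy hy).const_mul s
  have ix := (integrable_dotProduct hx hx).const_mul s⁻¹
  have h2 : ∫ ω, (-(s * (y ω ⬝ᵥ y ω)) - s⁻¹ * (x ω ⬝ᵥ x ω)) ∂Pr ≤ ∫ ω, x ω ⬝ᵥ y ω ∂Pr :=
    integral_mono (iy.neg.sub ix) (integrable_dotProduct hx hy) h1
  rw [integral_sub (by exact iy.neg) ix, integral_neg, integral_const_mul,
    integral_const_mul] at h2
  linarith

end Moments

/-! ### Superposition and the control-free filtration -/

section Filtration

variable {Ω : Type*} {n m p : ℕ} (S : LQProblem Ω n m p)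

/-- The noise-free response to the input `d`, started at `0`. -/
def forced (d : ℕ → Ω → Fin p → ℝ) : ℕ → Ω → Fin n → ℝ
  | 0 => fun _ => 0
  | t + 1 => fun ω => S.A *ᵥ forced d t ω + S.B *ᵥ d t ω

theorem state_eq_add_forced_sub (u u' : ℕ → Ω → Fin p → ℝ) (t : ℕ) (ω : Ω) :
    S.state u' t ω = S.state u t ω + S.forced (u' - u) t ω := by
  induction t with
  | zero => simp [state, forced]
  | succ t ih =>
    simp only [state, forced, ih, Pi.sub_apply, mulVec_add, mulVec_sub]
    abel

theorem state_eq_add_forced (u : ℕ → Ω → Fin p → ℝ) (t : ℕ) (ω : Ω) :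
    S.state u t ω = S.state 0 t ω + S.forced u t ω := by
  simpa using S.state_eq_add_forced_sub 0 u t ω

theorem forced_eq_add_forced_sub (u u' : ℕ → Ω → Fin p → ℝ) (t : ℕ)
    (ω : Ω) : S.forced u' t ω = S.forced u t ω + S.forced (u' - u) t ω := by
  have h := S.state_eq_add_forced_sub u u' t ω
  rw [S.state_eq_add_forced u', S.state_eq_add_forced u, add_assoc] at h
  exact add_left_cancel h

theorem output_eq_add_forced (u : ℕ → Ω → Fin p → ℝ) (t : ℕ) (ω : Ω) :
    S.output u t ω = S.output 0 t ω + S.C *ᵥ S.forced u t ω := by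
  simp only [output, S.state_eq_add_forced u t ω, mulVec_add]
  abel

/-- The σ-algebra generated by the outputs of the uncontrolled system up to time `t`. -/
@[reducible] def freeSigma (t : ℕ) : MeasurableSpace Ω :=
  ⨆ s ∈ Set.Iic t, MeasurableSpace.comap (S.output 0 s) inferInstance

theorem freeSigma_mono {s t : ℕ} (h : s ≤ t) : S.freeSigma s ≤ S.freeSigma t :=
  biSup_mono fun _ hr => le_trans hr h

theorem measurable_const_mulVec {G : MeasurableSpace Ω} {k l : ℕ} (M : Matrix (Fin k) (Fin l) ℝ)
    {x : Ω → Fin l → ℝ} (hx : Measurable x) : Measurable fun ω => M *ᵥ x ω :=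
  (continuous_const.matrix_mulVec continuous_id : Continuous fun y => M *ᵥ y).measurable.comp hx

theorem measurable_forced {G : MeasurableSpace Ω} {u : ℕ → Ω → Fin p → ℝ} {t : ℕ}
    (hu : ∀ s < t, Measurable (u s)) : Measurable (S.forced u t) := by
  induction t with
  | zero => exact measurable_const
  | succ t ih =>
    exact (measurable_const_mulVec S.A (ih fun s hs => hu s (hs.trans t.lt_succ_self))).add
      (measurable_const_mulVec S.B (hu t t.lt_succ_self))

theorem measurable_output_zero {s t : ℕ} (h : s ≤ t) : Measurable[S.freeSigma t] (S.output 0 s) :=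
  (comap_measurable _).mono (le_biSup (fun r => MeasurableSpace.comap (S.output 0 r) _) h) le_rfl

/-- The outputs with and without control differ by `C` times the response to earlier inputs, which
is measurable for either σ-algebra; each family of outputs is thus recovered from the other. -/
theorem infoSigma_eq {u : ℕ → Ω → Fin p → ℝ} {t : ℕ}
    (hu : ∀ s < t, Measurable[S.freeSigma s] (u s)) : S.infoSigma u t = S.freeSigma t := by
  refine le_antisymm (sup_le (iSup₂_le fun s hs => ?_) (iSup₂_le fun s hs => ?_))
    (iSup₂_le fun s hs => ?_)
  · refine Measurable.comap_le ?_
    have h1 : Measurable[S.freeSigma t] (S.forced u s) :=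
      S.measurable_forced fun r hr =>
        (hu r (hr.trans_le hs)).mono (S.freeSigma_mono (hr.le.trans hs)) le_rfl
    rw [show S.output u s = fun ω => S.output 0 s ω + S.C *ᵥ S.forced u s ω from
      funext (S.output_eq_add_forced u s)]
    exact (S.measurable_output_zero hs).add (measurable_const_mulVec S.C h1)
  · exact ((hu s hs).mono (S.freeSigma_mono (le_of_lt hs)) le_rfl).comap_le
  · refine Measurable.comap_le ?_
    have hy : Measurable[S.infoSigma u t] (S.output u s) :=
      (comap_measurable _).mono (le_sup_of_le_left
        (le_biSup (fun r => MeasurableSpace.comap (S.output u r) _) hs)) le_rfl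
    have hur : ∀ r < s, Measurable[S.infoSigma u t] (u r) := fun r hr =>
      (comap_measurable _).mono (le_sup_of_le_right
        (le_biSup (fun r => MeasurableSpace.comap (u r) _)
          (show r ∈ Set.Iio t from hr.trans_le hs))) le_rfl
    rw [show S.output 0 s = fun ω => S.output u s ω - S.C *ᵥ S.forced u s ω from
      funext fun ω => by rw [S.output_eq_add_forced u s ω, add_sub_cancel_right]]
    exact hy.sub (measurable_const_mulVec S.C (S.measurable_forced hur))

theorem obsSigma_eq {u : ℕ → Ω → Fin p → ℝ} {t : ℕ}
    (hu : ∀ s ≤ t, Measurable[S.freeSigma s] (u s)) : S.obsSigma u t = S.freeSigma t := by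
  have h1 : S.obsSigma u t = S.infoSigma u t ⊔ MeasurableSpace.comap (u t) inferInstance := by
    rw [obsSigma, infoSigma, sup_assoc]
    congr 1
    refine le_antisymm (iSup₂_le fun s hs => ?_) (sup_le ?_ ?_)
    · rcases (show s ≤ t from hs).lt_or_eq with h | rfl
      · exact le_sup_of_le_left (le_biSup (fun r => MeasurableSpace.comap (u r) _) h)
      · exact le_sup_right
    · exact biSup_mono fun _ hr => Set.Iio_subset_Iic_self hr
    · exact le_biSup (fun r => MeasurableSpace.comap (u r) _) (Set.self_mem_Iic)
  rw [h1, S.infoSigma_eq fun s hs => hu s hs.le, sup_eq_left]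
  exact (hu t le_rfl).comap_le

theorem obsSigma_zero (t : ℕ) : S.obsSigma 0 t = S.freeSigma t :=
  S.obsSigma_eq fun _ _ => measurable_const

theorem freeSigma_le_noise (t : ℕ) :
    S.freeSigma t ≤ ⨆ s ∈ Set.Iic t,
      MeasurableSpace.comap (fun ω => (S.w s ω, S.v s ω)) inferInstance := by
  set H : MeasurableSpace Ω := ⨆ s ∈ Set.Iic t,
      MeasurableSpace.comap (fun ω => (S.w s ω, S.v s ω)) inferInstance with hH
  have hwv : ∀ s ≤ t, Measurable[H] fun ω => (S.w s ω, S.v s ω) := fun s hs =>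
    (comap_measurable _).mono
      (le_biSup (fun r => MeasurableSpace.comap (fun ω => (S.w r ω, S.v r ω)) _) hs) le_rfl
  have hx : ∀ s ≤ t, Measurable[H] (S.state 0 s) := by
    intro s
    induction s with
    | zero => exact fun _ => measurable_const
    | succ s ih =>
      intro hs
      exact ((measurable_const_mulVec S.A (ih (by omega))).add
        (measurable_const_mulVec S.B measurable_const)).add (hwv _ hs).fst
  exact iSup₂_le fun s hs =>
    ((measurable_const_mulVec S.C (hx s hs)).add (hwv s hs).snd).comap_le

section Probability

variable [m0 : MeasurableSpace Ω] {S} {Pr : Measure Ω} {u : ℕ → Ω → Fin p → ℝ}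

/-- Strong induction: the information available at time `t` involves only earlier inputs, so it
equals `freeSigma t` once these are known to be adapted. -/
theorem measurable_of_admissible (hu : u ∈ S.admissible Pr) (t : ℕ) :
    t < S.N → Measurable[S.freeSigma t] (u t) := by
  induction t using Nat.strong_induction_on with
  | _ t ih =>
    intro ht
    rw [← S.infoSigma_eq fun s hs => ih s hs (hs.trans ht)]
    exact (hu t ht).1

theorem obsSigma_of_admissible (hu : u ∈ S.admissible Pr) {t : ℕ} (ht : t < S.N) :
    S.obsSigma u t = S.freeSigma t :=
  S.obsSigma_eq fun s hs => measurable_of_admissible hu s (hs.trans_lt ht)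

/-- Here the σ-algebra no longer depends on the policy, so the admissible set is seen to be a linear
space and differences of policies are admissible directions. -/
theorem admissible_iff :
    u ∈ S.admissible Pr ↔ ∀ t < S.N, Measurable[S.freeSigma t] (u t) ∧ MemLp (u t) 4 Pr := by
  refine ⟨fun hu t ht => ⟨measurable_of_admissible hu t ht, (hu t ht).2⟩, fun hu t ht => ?_⟩
  refine ⟨?_, (hu t ht).2⟩
  rw [S.infoSigma_eq fun s hs => (hu s (hs.trans ht)).1]
  exact (hu t ht).1

theorem zero_mem_admissible : (0 : ℕ → Ω → Fin p → ℝ) ∈ S.admissible Pr :=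
  fun _ _ => ⟨measurable_const, MemLp.zero⟩

theorem sub_mem_admissible {u' : ℕ → Ω → Fin p → ℝ} (hu : u ∈ S.admissible Pr)
    (hu' : u' ∈ S.admissible Pr) : u - u' ∈ S.admissible Pr := by
  rw [admissible_iff] at hu hu' ⊢
  exact fun t ht => ⟨(hu t ht).1.sub (hu' t ht).1, (hu t ht).2.sub (hu' t ht).2⟩

theorem measurable_state_zero (hw : ∀ t, Measurable (S.w t)) (t : ℕ) :
    Measurable (S.state 0 t) := by
  induction t with
  | zero => exact measurable_const
  | succ t ih =>
    exact ((measurable_const_mulVec S.A ih).add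
      (measurable_const_mulVec S.B measurable_const)).add (hw (t + 1))

theorem freeSigma_le (hw : ∀ t, Measurable (S.w t)) (hv : ∀ t, Measurable (S.v t)) (t : ℕ) :
    S.freeSigma t ≤ m0 :=
  iSup₂_le fun s _ => ((measurable_const_mulVec S.C (measurable_state_zero hw s)).add
    (hv s)).comap_le

variable [IsProbabilityMeasure Pr]

/-- `freeSigma t` is generated by noise up to time `t`, which is independent of the noise at time `t
+ 1`. -/
theorem condVec_noise (hw : ∀ t, Measurable (S.w t)) (hv : ∀ t, Measurable (S.v t))
    (hindep : iIndepFun (fun t ω => (S.w t ω, S.v t ω)) Pr)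
    (hident : ∀ t, IdentDistrib (fun ω => (S.w t ω, S.v t ω)) (fun ω => (S.w 0 ω, S.v 0 ω)) Pr Pr)
    (t : ℕ) : condVec Pr (S.freeSigma t) (S.w (t + 1)) =ᵐ[Pr] fun _ => S.wbar Pr := by
  have h1 : Indep (MeasurableSpace.comap (fun ω => (S.w (t + 1) ω, S.v (t + 1) ω)) inferInstance)
      (S.freeSigma t) Pr := by
    have := indep_iSup_of_disjoint (fun s => ((hw s).prodMk (hv s)).comap_le) hindep.iIndep
      (S := {t + 1}) (T := Set.Iic t) (by simp)
    simp only [Set.mem_singleton_iff, iSup_iSup_eq_left] at this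
    exact indep_of_indep_of_le_right this (S.freeSigma_le_noise t)
  have h2 : ∀ i, Pr[fun ω => S.w (t + 1) ω i | S.freeSigma t] =ᵐ[Pr] fun _ => S.wbar Pr i := by
    intro i
    have hm : Measurable[MeasurableSpace.comap
        (fun ω => (S.w (t + 1) ω, S.v (t + 1) ω)) inferInstance] fun ω => S.w (t + 1) ω i :=
      (measurable_pi_apply i).comp (comap_measurable _).fst
    have h3 := condExp_indep_eq (f := fun ω => S.w (t + 1) ω i)
      ((hw (t + 1)).prodMk (hv (t + 1))).comap_le
      (freeSigma_le hw hv t) hm.stronglyMeasurable h1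
    have h4 : IdentDistrib (fun ω => S.w (t + 1) ω i) (fun ω => S.w 1 ω i) Pr Pr :=
      ((hident (t + 1)).trans (hident 1).symm).comp
        ((measurable_pi_apply i).comp measurable_fst)
    rw [h4.integral_eq] at h3
    exact h3
  filter_upwards [ae_all_iff.2 h2] with ω hω
  ext i
  exact hω i

end Probability

end Filtration

/-! ### Independence of errors, gains and offsets from the control -/

section ControlIndependence

variable {Ω : Type*} {G : MeasurableSpace Ω} [m0 : MeasurableSpace Ω] {Pr : Measure Ω} {n m p : ℕ}
  {S : LQProblem Ω n m p} {u u' : ℕ → Ω → Fin p → ℝ}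

/-- The standing assumptions on the weights and on the noise. -/
structure Standing (S : LQProblem Ω n m p) (Pr : Measure Ω) : Prop where
  posQ : S.Q.PosSemidef
  posR : S.R.PosDef
  measurable_w : ∀ t, Measurable (S.w t)
  measurable_v : ∀ t, Measurable (S.v t)
  indep : iIndepFun (fun t ω => (S.w t ω, S.v t ω)) Pr
  ident : ∀ t, IdentDistrib (fun ω => (S.w t ω, S.v t ω)) (fun ω => (S.w 0 ω, S.v 0 ω)) Pr Pr
  moments : ∀ t i, AllMoments Pr fun ω => S.w t ω i

theorem memLp_forced {q : ℝ≥0∞} {t : ℕ} (hu : ∀ s < t, MemLp (u s) q Pr) (i : Fin n) :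
    MemLp (fun ω => S.forced u t ω i) q Pr := by
  induction t generalizing i with
  | zero => exact MemLp.zero
  | succ t ih =>
    exact (memLp_const_mulVec S.A (ih fun s hs => hu s (hs.trans t.lt_succ_self)) i).add
      (memLp_const_mulVec S.B (memLp_pi_iff.1 (hu t t.lt_succ_self)) i)

theorem memLp_forced_of_admissible (hu : u ∈ S.admissible Pr) {t : ℕ} (ht : t ≤ S.N) (i : Fin n) :
    MemLp (fun ω => S.forced u t ω i) 4 Pr :=
  memLp_forced (fun s hs => (hu s (hs.trans_le ht)).2) i

theorem measurable_forced_succ (hu : u ∈ S.admissible Pr) {t : ℕ} (ht : t < S.N) :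
    Measurable[S.freeSigma t] (S.forced u (t + 1)) :=
  S.measurable_forced fun s hs =>
    (measurable_of_admissible hu s (by omega)).mono (S.freeSigma_mono (by omega)) le_rfl

theorem measurable_forced_of_admissible (hu : u ∈ S.admissible Pr) {t : ℕ} (ht : t ≤ S.N) :
    Measurable[S.freeSigma t] (S.forced u t) :=
  S.measurable_forced fun s hs =>
    (measurable_of_admissible hu s (by omega)).mono (S.freeSigma_mono (by omega)) le_rfl

theorem Standing.freeSigma_le (H : S.Standing Pr) (t : ℕ) : S.freeSigma t ≤ m0 :=
  LQProblem.freeSigma_le H.measurable_w H.measurable_v t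

variable [IsProbabilityMeasure Pr]

theorem allMoments_const_mulVec {k l : ℕ} (M : Matrix (Fin k) (Fin l) ℝ) {x : Ω → Fin l → ℝ}
    (hx : ∀ i, AllMoments Pr fun ω => x ω i) (i : Fin k) :
    AllMoments Pr fun ω => (M *ᵥ x ω) i :=
  AllMoments.mulVec (M := fun _ => M) (fun i j => AllMoments.const (M i j)) hx i

namespace Standing

theorem allMoments_state_zero (H : S.Standing Pr) (t : ℕ) (i : Fin n) :
    AllMoments Pr fun ω => S.state 0 t ω i := by
  induction t generalizing i with
  | zero => exact AllMoments.const _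
  | succ t ih =>
    simp only [state, Pi.zero_apply, mulVec_zero, add_zero, Pi.add_apply]
    exact (allMoments_const_mulVec S.A ih i).add (H.moments (t + 1) i)

theorem memLp_state (H : S.Standing Pr) (hu : u ∈ S.admissible Pr) {t : ℕ} (ht : t ≤ S.N)
    (i : Fin n) : MemLp (fun ω => S.state u t ω i) 4 Pr := by
  simp only [S.state_eq_add_forced u, Pi.add_apply]
  exact (H.allMoments_state_zero t i).memLp_four.add (memLp_forced_of_admissible hu ht i)

theorem condVec_state (H : S.Standing Pr) (hG : G ≤ m0) {t : ℕ}
    (hu : ∀ s < t, MemLp (u s) 4 Pr) (hm : Measurable[G] (S.forced u t)) :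
    condVec Pr G (S.state u t) =ᵐ[Pr]
      fun ω => condVec Pr G (S.state 0 t) ω + S.forced u t ω := by
  have hi : ∀ i, Integrable (fun ω => S.forced u t ω i) Pr := fun i =>
    (memLp_forced hu i).integrable (by norm_num)
  have h := condVec_add (G := G) (fun i => (H.allMoments_state_zero t i).integrable) hi
  rw [condVec_of_measurable hG (x := S.forced u t) (fun i => (measurable_pi_apply i).comp hm) hi] at h
  rw [show S.state u t = fun ω => S.state 0 t ω + S.forced u t ω from
    funext (S.state_eq_add_forced u t)]
  exact h

theorem prediction_eq (H : S.Standing Pr) (hu : u ∈ S.admissible Pr) {t : ℕ} (ht : t < S.N) :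
    S.prediction Pr u (t + 1) =ᵐ[Pr]
      fun ω => S.prediction Pr 0 (t + 1) ω + S.forced u (t + 1) ω := by
  simp only [prediction, pastSigma, obsSigma_of_admissible hu ht, S.obsSigma_zero]
  exact H.condVec_state (H.freeSigma_le t) (fun s hs => (hu s (by omega)).2)
    (measurable_forced_succ hu ht)

theorem estimate_eq (H : S.Standing Pr) (hu : u ∈ S.admissible Pr) {t : ℕ} (ht : t < S.N) :
    S.estimate Pr u t =ᵐ[Pr] fun ω => S.estimate Pr 0 t ω + S.forced u t ω := by
  simp only [estimate, obsSigma_of_admissible hu ht, S.obsSigma_zero]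
  exact H.condVec_state (H.freeSigma_le t) (fun s hs => (hu s (by omega)).2)
    (measurable_forced_of_admissible hu ht.le)

theorem prediction_eq_add_forced_sub (H : S.Standing Pr) (hu : u ∈ S.admissible Pr)
    (hu' : u' ∈ S.admissible Pr) {t : ℕ} (ht : t < S.N) :
    S.prediction Pr u' (t + 1) =ᵐ[Pr]
      fun ω => S.prediction Pr u (t + 1) ω + S.forced (u' - u) (t + 1) ω := by
  filter_upwards [H.prediction_eq hu ht, H.prediction_eq hu' ht] with ω h1 h2
  rw [h1, h2, S.forced_eq_add_forced_sub u u', add_assoc]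

theorem predErr_eq (H : S.Standing Pr) (hu : u ∈ S.admissible Pr) {t : ℕ} (ht : t < S.N) :
    S.predErr Pr u (t + 1) =ᵐ[Pr] S.predErr Pr 0 (t + 1) := by
  filter_upwards [H.prediction_eq hu ht] with ω h1
  rw [predErr, predErr, h1, S.state_eq_add_forced u]
  abel

theorem refineErr_eq (H : S.Standing Pr) (hu : u ∈ S.admissible Pr) {t : ℕ} (ht : t + 1 < S.N) :
    S.refineErr Pr u (t + 1) =ᵐ[Pr] S.refineErr Pr 0 (t + 1) := by
  filter_upwards [H.prediction_eq hu (t.lt_succ_self.trans ht), H.estimate_eq hu ht] with ω h1 h2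
  rw [refineErr, refineErr, h1, h2]
  abel

theorem condCov_eq (H : S.Standing Pr) (hu : u ∈ S.admissible Pr) {t : ℕ} (ht : t < S.N) :
    S.condCov Pr u t =ᵐ[Pr] S.condCov Pr 0 t := by
  simp only [condCov, obsSigma_of_admissible hu ht, S.obsSigma_zero]
  exact condMat_congr ((H.predErr_eq hu ht).mono fun ω h => by simp only [h])

theorem condThird_eq (H : S.Standing Pr) (hu : u ∈ S.admissible Pr) {t : ℕ} (ht : t < S.N) :
    S.condThird Pr u t =ᵐ[Pr] S.condThird Pr 0 t := by
  have h := condVec_congr (G := S.freeSigma t) ((H.predErr_eq hu ht).mono fun ω h => by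
    show (S.predErr Pr u (t + 1) ω ⬝ᵥ (S.Q *ᵥ S.predErr Pr u (t + 1) ω)) •
      S.predErr Pr u (t + 1) ω = (S.predErr Pr 0 (t + 1) ω ⬝ᵥ
        (S.Q *ᵥ S.predErr Pr 0 (t + 1) ω)) • S.predErr Pr 0 (t + 1) ω
    rw [h])
  filter_upwards [h] with ω hω
  simp only [condThird, obsSigma_of_admissible hu ht, S.obsSigma_zero, hω]

section Step

variable {mu : ℝ} {t : ℕ} {next next' : (Ω → Matrix (Fin n) (Fin n) ℝ) × (Ω → Fin n → ℝ)}

theorem stepV_congr (H : S.Standing Pr) (hu : u ∈ S.admissible Pr) (ht : t < S.N)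
    (h1 : next.1 =ᵐ[Pr] next'.1) : S.stepV Pr mu u t next =ᵐ[Pr] S.stepV Pr mu 0 t next' := by
  filter_upwards [condMat_congr (G := S.freeSigma t) h1, H.condCov_eq hu ht] with ω hω hW
  simp only [stepV, inflatedPenalty, obsSigma_of_admissible hu ht, S.obsSigma_zero, hω, hW]

theorem stepXi_congr (H : S.Standing Pr) (hu : u ∈ S.admissible Pr) (ht : t < S.N)
    (h1 : (fun ω => next.1 ω *ᵥ S.refineErr Pr u (t + 1) ω) =ᵐ[Pr]
      fun ω => next'.1 ω *ᵥ S.refineErr Pr 0 (t + 1) ω)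
    (h2 : next.2 =ᵐ[Pr] next'.2) : S.stepXi Pr mu u t next =ᵐ[Pr] S.stepXi Pr mu 0 t next' := by
  have h := condVec_congr (G := S.freeSigma t) (h1.add h2)
  filter_upwards [h, H.condThird_eq hu ht] with ω hω hm
  simp only [stepXi, obsSigma_of_admissible hu ht, S.obsSigma_zero, hm]
  exact congrArg (· + _) hω

end Step

theorem step_costToGo_eq (H : S.Standing Pr) (mu : ℝ) (hu : u ∈ S.admissible Pr) {t : ℕ}
    (ht : t < S.N)
    (h : (S.costToGo Pr mu u (t + 1)).1 =ᵐ[Pr] (S.costToGo Pr mu 0 (t + 1)).1 ∧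
      (S.costToGo Pr mu u (t + 1)).2 =ᵐ[Pr] (S.costToGo Pr mu 0 (t + 1)).2) :
    S.stepV Pr mu u t (S.costToGo Pr mu u (t + 1)) =ᵐ[Pr]
        S.stepV Pr mu 0 t (S.costToGo Pr mu 0 (t + 1)) ∧
      S.stepXi Pr mu u t (S.costToGo Pr mu u (t + 1)) =ᵐ[Pr]
        S.stepXi Pr mu 0 t (S.costToGo Pr mu 0 (t + 1)) := by
  refine ⟨H.stepV_congr hu ht h.1, H.stepXi_congr hu ht ?_ h.2⟩
  -- At `t + 1 = N` the refinement error may depend on `u`, since `F_N` contains the unconstrained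
  -- input `u_N`; there `P_N = 0` removes it.
  rcases (Nat.succ_le_of_lt ht).eq_or_lt with h1 | h1
  · simp only [Nat.succ_eq_add_one] at h1
    rw [h1, costToGo_terminal, costToGo_terminal]
    simp
  · filter_upwards [h.1, H.refineErr_eq hu h1] with ω h2 h3
    rw [h2, h3]

theorem costToGo_eq (H : S.Standing Pr) (mu : ℝ) (hu : u ∈ S.admissible Pr) {t : ℕ}
    (ht : t ≤ S.N) : (S.costToGo Pr mu u t).1 =ᵐ[Pr] (S.costToGo Pr mu 0 t).1 ∧
      (S.costToGo Pr mu u t).2 =ᵐ[Pr] (S.costToGo Pr mu 0 t).2 := by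
  induction ht using Nat.decreasingInduction with
  | self => simp only [costToGo_terminal]; exact ⟨.rfl, .rfl⟩
  | of_succ t ht ih =>
    obtain ⟨hV, hX⟩ := H.step_costToGo_eq mu hu ht ih
    rw [costToGo_step _ _ _ _ _ ht, costToGo_step _ _ _ _ _ ht]
    constructor
    · filter_upwards [hV] with ω hV
      simp only [stepP, stepK, hV]
    · filter_upwards [hV, hX] with ω hV hX
      simp only [stepZeta, stepK, hV, hX]

theorem gain_eq (H : S.Standing Pr) (mu : ℝ) (hu : u ∈ S.admissible Pr) {t : ℕ}
    (ht : t < S.N) : S.gain Pr mu u t =ᵐ[Pr] S.gain Pr mu 0 t := by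
  filter_upwards [(H.step_costToGo_eq mu hu ht (H.costToGo_eq mu hu ht)).1] with ω hV
  simp only [gain, stepK, hV]

theorem offset_eq (H : S.Standing Pr) (mu : ℝ) (hu : u ∈ S.admissible Pr) {t : ℕ}
    (ht : t < S.N) : S.offset Pr mu u t =ᵐ[Pr] S.offset Pr mu 0 t := by
  obtain ⟨hV, hX⟩ := H.step_costToGo_eq mu hu ht (H.costToGo_eq mu hu ht)
  filter_upwards [hV, hX] with ω hV hX
  simp only [offset, stepL, hV, hX]

end Standing

end ControlIndependence

/-! ### Measurability and moments of the backward recursion -/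

section Regularity

variable {Ω : Type*} {G : MeasurableSpace Ω}

theorem measurable_matrix_mul {k l r : ℕ} {M : Ω → Matrix (Fin k) (Fin l) ℝ}
    {N : Ω → Matrix (Fin l) (Fin r) ℝ} (hM : ∀ i j, Measurable[G] fun ω => M ω i j)
    (hN : ∀ i j, Measurable[G] fun ω => N ω i j) (i : Fin k) (j : Fin r) :
    Measurable[G] fun ω => (M ω * N ω) i j := by
  simp only [mul_apply]
  exact Finset.measurable_fun_sum _ fun a _ => (hM i a).mul (hN a j)

theorem measurable_mulVec {k l : ℕ} {M : Ω → Matrix (Fin k) (Fin l) ℝ} {x : Ω → Fin l → ℝ}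
    (hM : ∀ i j, Measurable[G] fun ω => M ω i j) (hx : ∀ i, Measurable[G] fun ω => x ω i)
    (i : Fin k) : Measurable[G] fun ω => (M ω *ᵥ x ω) i := by
  simp only [Matrix.mulVec, dotProduct]
  exact Finset.measurable_fun_sum _ fun a _ => (hM i a).mul (hx a)

theorem measurable_mul_const {k l r : ℕ} {M : Ω → Matrix (Fin k) (Fin l) ℝ}
    (hM : ∀ i j, Measurable[G] fun ω => M ω i j) (N : Matrix (Fin l) (Fin r) ℝ)
    (i : Fin k) (j : Fin r) : Measurable[G] fun ω => (M ω * N) i j :=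
  measurable_matrix_mul (N := fun _ => N) hM (fun _ _ => measurable_const) i j

theorem measurable_const_mul {k l r : ℕ} (N : Matrix (Fin k) (Fin l) ℝ)
    {M : Ω → Matrix (Fin l) (Fin r) ℝ} (hM : ∀ i j, Measurable[G] fun ω => M ω i j)
    (i : Fin k) (j : Fin r) : Measurable[G] fun ω => (N * M ω) i j :=
  measurable_matrix_mul (M := fun _ => N) (fun _ _ => measurable_const) hM i j

theorem measurable_const_mulVec_apply {k l : ℕ} (M : Matrix (Fin k) (Fin l) ℝ)
    {x : Ω → Fin l → ℝ} (hx : ∀ i, Measurable[G] fun ω => x ω i) (i : Fin k) :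
    Measurable[G] fun ω => (M *ᵥ x ω) i :=
  measurable_mulVec (M := fun _ => M) (fun _ _ => measurable_const) hx i

variable [m0 : MeasurableSpace Ω] {Pr : Measure Ω} {n m p : ℕ} {S : LQProblem Ω n m p}

theorem measurable_condVec {k : ℕ} {x : Ω → Fin k → ℝ} (i : Fin k) :
    Measurable[G] fun ω => condVec Pr G x ω i := stronglyMeasurable_condExp.measurable

theorem measurable_condMat {k l : ℕ} {M : Ω → Matrix (Fin k) (Fin l) ℝ} (i : Fin k) (j : Fin l) :
    Measurable[G] fun ω => condMat Pr G M ω i j := stronglyMeasurable_condExp.measurable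

section ZeroMeasurable

variable (t : ℕ) (mu : ℝ) (next : (Ω → Matrix (Fin n) (Fin n) ℝ) × (Ω → Fin n → ℝ))

theorem measurable_estimate_zero (i : Fin n) :
    Measurable[S.freeSigma t] fun ω => S.estimate Pr 0 t ω i := by
  rw [estimate, S.obsSigma_zero]
  exact measurable_condVec i

theorem measurable_condCov_zero (i j : Fin n) :
    Measurable[S.freeSigma t] fun ω => S.condCov Pr 0 t ω i j := by
  rw [condCov, S.obsSigma_zero]
  exact measurable_condMat i j

theorem measurable_condThird_zero (i : Fin n) :
    Measurable[S.freeSigma t] fun ω => S.condThird Pr 0 t ω i := by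
  simp only [condThird, S.obsSigma_zero, Pi.smul_apply, smul_eq_mul]
  exact (measurable_const_mulVec_apply S.Q measurable_condVec i).const_mul _

theorem measurable_stepV_zero (i j : Fin n) :
    Measurable[S.freeSigma t] fun ω => S.stepV Pr mu 0 t next ω i j := by
  simp only [stepV, inflatedPenalty, S.obsSigma_zero, Matrix.add_apply, Matrix.smul_apply,
    smul_eq_mul]
  exact (measurable_condMat i j).add (measurable_const.add ((measurable_mul_const
    (measurable_const_mul S.Q (measurable_condCov_zero t)) S.Q i j).const_mul _))

theorem measurable_stepXi_zero (i : Fin n) :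
    Measurable[S.freeSigma t] fun ω => S.stepXi Pr mu 0 t next ω i := by
  simp only [stepXi, S.obsSigma_zero, Pi.add_apply, Pi.smul_apply, smul_eq_mul]
  exact (measurable_condVec i).add ((measurable_condThird_zero t i).const_mul _)

theorem measurable_inverse_zero (i j : Fin p) : Measurable[S.freeSigma t] fun ω =>
    (S.Bᵀ * S.stepV Pr mu 0 t next ω * S.B + S.R)⁻¹ i j := by
  refine measurable_matrix_inv (fun a b => ?_) i j
  exact (measurable_mul_const (measurable_const_mul S.Bᵀ
    (measurable_stepV_zero t mu next)) S.B a b).add measurable_const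

theorem measurable_stepK_zero (i : Fin p) (j : Fin n) :
    Measurable[S.freeSigma t] fun ω => S.stepK Pr mu 0 t next ω i j :=
  (measurable_matrix_mul (measurable_inverse_zero t mu next) (measurable_mul_const
    (measurable_const_mul S.Bᵀ (measurable_stepV_zero t mu next)) S.A) i j).neg

theorem measurable_stepL_zero (i : Fin p) :
    Measurable[S.freeSigma t] fun ω => S.stepL Pr mu 0 t next ω i :=
  (measurable_mulVec (measurable_inverse_zero t mu next) (measurable_const_mulVec_apply
    S.Bᵀ fun a => (measurable_stepXi_zero t mu next a).add
      (measurable_mulVec (x := fun _ => S.wbar Pr) (measurable_stepV_zero t mu next)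
        (fun _ => measurable_const) a)) i).neg

end ZeroMeasurable

variable [IsProbabilityMeasure Pr]

theorem allMoments_mul_const {k l r : ℕ} {M : Ω → Matrix (Fin k) (Fin l) ℝ}
    (hM : ∀ i j, AllMoments Pr fun ω => M ω i j) (N : Matrix (Fin l) (Fin r) ℝ)
    (i : Fin k) (j : Fin r) : AllMoments Pr fun ω => (M ω * N) i j :=
  AllMoments.matrix_mul (N := fun _ => N) hM (fun _ _ => AllMoments.const _) i j

theorem allMoments_const_mul {k l r : ℕ} (N : Matrix (Fin k) (Fin l) ℝ)
    {M : Ω → Matrix (Fin l) (Fin r) ℝ} (hM : ∀ i j, AllMoments Pr fun ω => M ω i j)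
    (i : Fin k) (j : Fin r) : AllMoments Pr fun ω => (N * M ω) i j :=
  AllMoments.matrix_mul (M := fun _ => N) (fun _ _ => AllMoments.const _) hM i j

namespace Standing

theorem allMoments_prediction_zero (H : S.Standing Pr) (t : ℕ) (i : Fin n) :
    AllMoments Pr fun ω => S.prediction Pr 0 t ω i :=
  (H.allMoments_state_zero t i).condExp

theorem allMoments_estimate_zero (H : S.Standing Pr) (t : ℕ) (i : Fin n) :
    AllMoments Pr fun ω => S.estimate Pr 0 t ω i :=
  (H.allMoments_state_zero t i).condExp

theorem allMoments_predErr_zero (H : S.Standing Pr) (t : ℕ) (i : Fin n) :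
    AllMoments Pr fun ω => S.predErr Pr 0 t ω i :=
  (H.allMoments_state_zero t i).sub (H.allMoments_prediction_zero t i)

theorem allMoments_refineErr_zero (H : S.Standing Pr) (t : ℕ) (i : Fin n) :
    AllMoments Pr fun ω => S.refineErr Pr 0 t ω i :=
  (H.allMoments_estimate_zero t i).sub (H.allMoments_prediction_zero t i)

theorem allMoments_condCov_zero (H : S.Standing Pr) (t : ℕ) (i j : Fin n) :
    AllMoments Pr fun ω => S.condCov Pr 0 t ω i j :=
  ((H.allMoments_predErr_zero (t + 1) i).mul (H.allMoments_predErr_zero (t + 1) j)).condExp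

theorem allMoments_condThird_zero (H : S.Standing Pr) (t : ℕ) (i : Fin n) :
    AllMoments Pr fun ω => S.condThird Pr 0 t ω i := by
  refine (allMoments_const_mulVec S.Q (fun j => AllMoments.condExp ?_) i).const_mul 2
  simp only [Pi.smul_apply, smul_eq_mul]
  refine AllMoments.mul ?_ (H.allMoments_predErr_zero (t + 1) j)
  exact AllMoments.sum fun a => (H.allMoments_predErr_zero (t + 1) a).mul
    (allMoments_const_mulVec S.Q (H.allMoments_predErr_zero (t + 1)) a)

theorem condCov_zero_posSemidef (H : S.Standing Pr) (t : ℕ) :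
    ∀ᵐ ω ∂Pr, (S.condCov Pr 0 t ω).PosSemidef :=
  condMat_posSemidef
    (ae_of_all _ fun ω => by
      simpa using posSemidef_vecMulVec_self_star (S.predErr Pr 0 (t + 1) ω))
    fun i j => ((H.allMoments_predErr_zero (t + 1) i).mul
      (H.allMoments_predErr_zero (t + 1) j)).integrable

/-- Regularity of a pair `(P_{t+1}, ζ_{t+1})`: `P` is positive semidefinite, and all entries have
all moments. -/
structure Regular (Pr : Measure Ω)
    (next : (Ω → Matrix (Fin n) (Fin n) ℝ) × (Ω → Fin n → ℝ)) : Prop where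
  posSemidef : ∀ᵐ ω ∂Pr, (next.1 ω).PosSemidef
  fst : ∀ i j, AllMoments Pr fun ω => next.1 ω i j
  snd : ∀ i, AllMoments Pr fun ω => next.2 ω i

section Step

variable {mu : ℝ} {t : ℕ} {next : (Ω → Matrix (Fin n) (Fin n) ℝ) × (Ω → Fin n → ℝ)}

theorem stepV_posSemidef (H : S.Standing Pr) (hmu : 0 ≤ mu) (hn : Regular Pr next) :
    ∀ᵐ ω ∂Pr, (S.stepV Pr mu 0 t next ω).PosSemidef := by
  filter_upwards [condMat_posSemidef (G := S.obsSigma 0 t) hn.posSemidef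
    fun i j => (hn.fst i j).integrable, H.condCov_zero_posSemidef t] with ω h1 h2
  refine h1.add (H.posQ.add (PosSemidef.smul ?_ (by positivity)))
  have := h2.conjTranspose_mul_mul_same S.Q
  rwa [H.posQ.1.eq] at this

theorem allMoments_stepV (H : S.Standing Pr) (hn : Regular Pr next) (i j : Fin n) :
    AllMoments Pr fun ω => S.stepV Pr mu 0 t next ω i j := by
  simp only [stepV, inflatedPenalty, Matrix.add_apply, Matrix.smul_apply, smul_eq_mul]
  exact (hn.fst i j).condExp.add ((AllMoments.const _).add ((allMoments_mul_const
    (allMoments_const_mul _ (H.allMoments_condCov_zero t)) _ i j).const_mul _))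

theorem allMoments_stepXi (H : S.Standing Pr) (hn : Regular Pr next) (i : Fin n) :
    AllMoments Pr fun ω => S.stepXi Pr mu 0 t next ω i := by
  refine AllMoments.add (AllMoments.condExp ?_) ((H.allMoments_condThird_zero t i).const_mul _)
  exact (AllMoments.mulVec hn.fst (H.allMoments_refineErr_zero (t + 1)) i).add (hn.snd i)

theorem allMoments_stepXi_add (H : S.Standing Pr) (hn : Regular Pr next) (i : Fin n) :
    AllMoments Pr fun ω =>
      (S.stepXi Pr mu 0 t next ω + S.stepV Pr mu 0 t next ω *ᵥ S.wbar Pr) i :=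
  (H.allMoments_stepXi hn i).add
    (AllMoments.mulVec (x := fun _ => S.wbar Pr) (H.allMoments_stepV hn) (fun _ => AllMoments.const _) i)

/-- Since `V` is positive semidefinite, `B' V B + R` inherits the coercivity constant of `R`; the
inverse is therefore bounded even where `V` is not. -/
theorem allMoments_inverse (H : S.Standing Pr) (hmu : 0 ≤ mu) (hn : Regular Pr next)
    (i j : Fin p) : AllMoments Pr fun ω =>
      (S.Bᵀ * S.stepV Pr mu 0 t next ω * S.B + S.R)⁻¹ i j := by
  obtain ⟨c, hc, hR⟩ := H.posR.exists_coercive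
  refine AllMoments.of_bound (((measurable_inverse_zero t mu next i j).mono
    (H.freeSigma_le t) le_rfl).aestronglyMeasurable) c⁻¹ ?_
  filter_upwards [H.stepV_posSemidef hmu hn] with ω hω
  exact abs_inv_apply_le_of_coercive hc (hω.coercive_conj_add S.B hR) i j

theorem allMoments_stepK (H : S.Standing Pr) (hmu : 0 ≤ mu) (hn : Regular Pr next)
    (i : Fin p) (j : Fin n) : AllMoments Pr fun ω => S.stepK Pr mu 0 t next ω i j :=
  (AllMoments.matrix_mul (H.allMoments_inverse hmu hn)
    (allMoments_mul_const (allMoments_const_mul _ (H.allMoments_stepV hn)) _) i j).neg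

theorem allMoments_stepL (H : S.Standing Pr) (hmu : 0 ≤ mu) (hn : Regular Pr next)
    (i : Fin p) : AllMoments Pr fun ω => S.stepL Pr mu 0 t next ω i :=
  (AllMoments.mulVec (H.allMoments_inverse hmu hn)
    (allMoments_const_mulVec _ (H.allMoments_stepXi_add hn)) i).neg

theorem regular_step (H : S.Standing Pr) (hmu : 0 ≤ mu) (hn : Regular Pr next) :
    Regular Pr (S.stepP Pr mu 0 t next, S.stepZeta Pr mu 0 t next) := by
  have hK := H.allMoments_stepK (t := t) hmu hn
  have hABK : ∀ i j, AllMoments Pr fun ω => (S.A + S.B * S.stepK Pr mu 0 t next ω) i j :=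
    fun i j => (AllMoments.const _).add (allMoments_const_mul _ hK i j)
  refine ⟨?_, fun i j => ?_, fun i => ?_⟩
  · filter_upwards [H.stepV_posSemidef (t := t) hmu hn] with ω hω
    have h1 := hω.conjTranspose_mul_mul_same (S.A + S.B * S.stepK Pr mu 0 t next ω)
    have h2 := H.posR.posSemidef.conjTranspose_mul_mul_same (S.stepK Pr mu 0 t next ω)
    rw [conjTranspose_eq_transpose_of_trivial] at h1 h2
    exact h1.add h2
  · exact (AllMoments.matrix_mul (AllMoments.matrix_mul
        (M := fun ω => (S.A + S.B * S.stepK Pr mu 0 t next ω)ᵀ) (fun a b => hABK b a)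
        (H.allMoments_stepV hn)) hABK i j).add
      (AllMoments.matrix_mul (allMoments_mul_const (M := fun ω => (S.stepK Pr mu 0 t next ω)ᵀ)
        (fun a b => hK b a) _) hK i j)
  · exact AllMoments.mulVec (M := fun ω => (S.A + S.B * S.stepK Pr mu 0 t next ω)ᵀ)
      (fun a b => hABK b a) (H.allMoments_stepXi_add hn) i

end Step

theorem regular_costToGo_zero (H : S.Standing Pr) {mu : ℝ} (hmu : 0 ≤ mu) {t : ℕ}
    (ht : t ≤ S.N) : Regular Pr (S.costToGo Pr mu 0 t) := by
  induction ht using Nat.decreasingInduction with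
  | self =>
    rw [costToGo_terminal]
    exact ⟨ae_of_all _ fun _ => PosSemidef.zero, fun _ _ => AllMoments.const 0,
      fun _ => AllMoments.const 0⟩
  | of_succ t ht ih =>
    rw [costToGo_step _ _ _ _ _ ht]
    exact H.regular_step hmu ih

theorem regular_costToGo (H : S.Standing Pr) {mu : ℝ} (hmu : 0 ≤ mu)
    {u : ℕ → Ω → Fin p → ℝ} (hu : u ∈ S.admissible Pr) {t : ℕ} (ht : t ≤ S.N) :
    Regular Pr (S.costToGo Pr mu u t) := by
  have h := H.regular_costToGo_zero hmu ht
  obtain ⟨h1, h2⟩ := H.costToGo_eq mu hu ht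
  refine ⟨?_, fun i j => (h.fst i j).congr ?_, fun i => (h.snd i).congr ?_⟩
  · filter_upwards [h1, h.posSemidef] with ω h1 h2
    rw [h1]
    exact h2
  · exact h1.mono fun ω hω => by simp only [hω]
  · exact h2.mono fun ω hω => by simp only [hω]

end Standing

/-! ### Existence of the controller -/

/-- The forced response of the closed loop with gains `K`, offsets `l` and uncontrolled
estimates `z`. -/
def feedbackForced (S : LQProblem Ω n m p) (K : ℕ → Ω → Matrix (Fin p) (Fin n) ℝ)
    (l : ℕ → Ω → Fin p → ℝ) (z : ℕ → Ω → Fin n → ℝ) : ℕ → Ω → Fin n → ℝ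
  | 0 => fun _ => 0
  | t + 1 => fun ω => S.A *ᵥ feedbackForced S K l z t ω +
      S.B *ᵥ (K t ω *ᵥ (z t ω + feedbackForced S K l z t ω) + l t ω)

/-- Gains, offsets and free estimates are those of the zero input, so the loop can be closed by a
forward recursion; only afterwards are they identified with those of the resulting policy. -/
theorem Standing.exists_isRiskAwareController (H : S.Standing Pr) {mu : ℝ} (hmu : 0 ≤ mu) :
    ∃ u, S.IsRiskAwareController Pr mu u := by
  set K := S.gain Pr mu 0 with hK
  set l := S.offset Pr mu 0 with hl
  set z := S.estimate Pr 0 with hz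
  set F := S.feedbackForced K l z with hF
  set u : ℕ → Ω → Fin p → ℝ := fun t ω => K t ω *ᵥ (z t ω + F t ω) + l t ω with hu
  have hforced : ∀ t, S.forced u t = F t := by
    intro t
    induction t with
    | zero => rfl
    | succ t ih =>
      ext1 ω
      simp only [forced, ih]
      rfl
  have hum : ∀ t, (∀ i, Measurable[S.freeSigma t] fun ω => F t ω i) →
      ∀ i, Measurable[S.freeSigma t] fun ω => u t ω i := fun t hFt i =>
    (measurable_mulVec (measurable_stepK_zero t mu _)
      (fun j => (measurable_estimate_zero t j).add (hFt j)) i).add (measurable_stepL_zero t mu _ i)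
  have hFm : ∀ t i, Measurable[S.freeSigma t] fun ω => F t ω i := by
    intro t
    induction t with
    | zero => exact fun _ => measurable_const
    | succ t ih =>
      intro i
      refine Measurable.mono ?_ (S.freeSigma_mono t.le_succ) le_rfl
      exact (measurable_const_mulVec_apply S.A ih i).add
        (measurable_const_mulVec_apply S.B (hum t ih) i)
  have hua : ∀ t < S.N, (∀ i, AllMoments Pr fun ω => F t ω i) →
      ∀ i, AllMoments Pr fun ω => u t ω i := by
    intro t ht hFt i
    have hreg := H.regular_costToGo_zero hmu (show t + 1 ≤ S.N from ht)
    exact (AllMoments.mulVec (H.allMoments_stepK hmu hreg)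
      (fun j => (H.allMoments_estimate_zero t j).add (hFt j)) i).add
        (H.allMoments_stepL hmu hreg i)
  have hFa : ∀ t ≤ S.N, ∀ i, AllMoments Pr fun ω => F t ω i := by
    intro t
    induction t with
    | zero => exact fun _ _ => AllMoments.const 0
    | succ t ih =>
      intro ht i
      exact (allMoments_const_mulVec S.A (ih (by omega)) i).add
        (allMoments_const_mulVec S.B (hua t ht (ih (by omega))) i)
  have hadm : u ∈ S.admissible Pr := by
    rw [admissible_iff]
    exact fun t ht => ⟨(@measurable_pi_iff _ _ _ (S.freeSigma t) _ _).2 (hum t (hFm t)),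
      memLp_pi_iff.2 fun i => (hua t ht (hFa t ht.le) i).memLp_four⟩
  refine ⟨u, hadm, fun t ht => ?_⟩
  filter_upwards [H.gain_eq mu hadm ht, H.offset_eq mu hadm ht, H.estimate_eq hadm ht]
    with ω h1 h2 h3
  rw [h1, h2, h3, hforced t]

end Regularity

/-! ### Convexity of cost and risk -/

section Optimality

variable {Ω : Type*} [m0 : MeasurableSpace Ω] {Pr : Measure Ω} {n m p : ℕ}
  {S : LQProblem Ω n m p} {u u' d : ℕ → Ω → Fin p → ℝ}

/-- The squared `L²`-norm of an input process on the horizon. -/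
noncomputable def inputEnergy (S : LQProblem Ω n m p) (Pr : Measure Ω)
    (d : ℕ → Ω → Fin p → ℝ) : ℝ :=
  ∑ t ∈ Finset.range S.N, ∫ ω, d t ω ⬝ᵥ d t ω ∂Pr

/-- Half the derivative of the cost at `u` in direction `d`. -/
noncomputable def costSlope (S : LQProblem Ω n m p) (Pr : Measure Ω)
    (u d : ℕ → Ω → Fin p → ℝ) : ℝ :=
  ∑ t ∈ Finset.range S.N, (∫ ω, S.forced d (t + 1) ω ⬝ᵥ (S.Q *ᵥ S.state u (t + 1) ω) ∂Pr +
    ∫ ω, d t ω ⬝ᵥ (S.R *ᵥ u t ω) ∂Pr)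

/-- The gradient of the risk density with respect to the prediction, up to a factor `2`. -/
noncomputable def riskGradient (S : LQProblem Ω n m p) (Pr : Measure Ω)
    (u : ℕ → Ω → Fin p → ℝ) (t : ℕ) (ω : Ω) : Fin n → ℝ :=
  (4 : ℝ) • ((S.Q * S.condCov Pr u t ω * S.Q) *ᵥ S.prediction Pr u (t + 1) ω) +
    S.condThird Pr u t ω

/-- Half the derivative of the risk at `u` in direction `d`. -/
noncomputable def riskSlope (S : LQProblem Ω n m p) (Pr : Measure Ω)
    (u d : ℕ → Ω → Fin p → ℝ) : ℝ :=
  ∑ t ∈ Finset.range S.N, ∫ ω, S.forced d (t + 1) ω ⬝ᵥ S.riskGradient Pr u t ω ∂Pr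

theorem dotProduct_self_nonneg {k : ℕ} (x : Fin k → ℝ) : 0 ≤ x ⬝ᵥ x := by
  simpa using dotProduct_star_self_nonneg x

theorem mulVec_dotProduct_self_le {k l : ℕ} (M : Matrix (Fin k) (Fin l) ℝ) :
    ∃ C, 0 ≤ C ∧ ∀ x : Fin l → ℝ, (M *ᵥ x) ⬝ᵥ (M *ᵥ x) ≤ C * (x ⬝ᵥ x) := by
  refine ⟨∑ i, ∑ j, M i j ^ 2, by positivity, fun x => ?_⟩
  have h : ∀ i, (M *ᵥ x) i * (M *ᵥ x) i ≤ (∑ j, M i j ^ 2) * ∑ j, x j ^ 2 := fun i => by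
    rw [← pow_two]
    exact Finset.sum_mul_sq_le_sq_mul_sq Finset.univ (M i) x
  calc (M *ᵥ x) ⬝ᵥ (M *ᵥ x) ≤ ∑ i, (∑ j, M i j ^ 2) * ∑ j, x j ^ 2 :=
        Finset.sum_le_sum fun i _ => h i
    _ = _ := by rw [← Finset.sum_mul]; simp only [dotProduct, pow_two]

theorem add_dotProduct_self_le {k : ℕ} (x y : Fin k → ℝ) :
    (x + y) ⬝ᵥ (x + y) ≤ 2 * (x ⬝ᵥ x) + 2 * (y ⬝ᵥ y) := by
  have h := dotProduct_self_nonneg (x - y)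
  simp only [sub_dotProduct, dotProduct_sub, add_dotProduct, dotProduct_add] at h ⊢
  linarith

/-- Expansion of a quadratic form with symmetric matrix. -/
theorem quadForm_add {k : ℕ} {M : Matrix (Fin k) (Fin k) ℝ} (hM : Mᵀ = M) (x y : Fin k → ℝ) :
    (x + y) ⬝ᵥ (M *ᵥ (x + y)) = x ⬝ᵥ (M *ᵥ x) + 2 * (y ⬝ᵥ (M *ᵥ x)) + y ⬝ᵥ (M *ᵥ y) := by
  have h : x ⬝ᵥ (M *ᵥ y) = y ⬝ᵥ (M *ᵥ x) := by
    rw [dotProduct_mulVec, ← mulVec_transpose, hM, dotProduct_comm]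
  simp only [mulVec_add, add_dotProduct, dotProduct_add, h]
  ring

theorem transpose_eq_of_posSemidef {k : ℕ} {M : Matrix (Fin k) (Fin k) ℝ} (hM : M.PosSemidef) :
    Mᵀ = M := by
  rw [← conjTranspose_eq_transpose_of_trivial]
  exact hM.1

theorem memLp_of_admissible (hu : u ∈ S.admissible Pr) {t : ℕ} (ht : t < S.N) (i : Fin p) :
    MemLp (fun ω => u t ω i) 4 Pr :=
  memLp_pi_iff.1 (hu t ht).2 i

theorem inputEnergy_nonneg (d : ℕ → Ω → Fin p → ℝ) : 0 ≤ S.inputEnergy Pr d :=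
  Finset.sum_nonneg fun _ _ => integral_nonneg fun _ => dotProduct_self_nonneg _

theorem inputEnergy_sub_comm (u v : ℕ → Ω → Fin p → ℝ) :
    S.inputEnergy Pr (u - v) = S.inputEnergy Pr (v - u) := by
  refine Finset.sum_congr rfl fun t _ => integral_congr_ae (ae_of_all _ fun ω => ?_)
  show (u t ω - v t ω) ⬝ᵥ (u t ω - v t ω) = (v t ω - u t ω) ⬝ᵥ (v t ω - u t ω)
  rw [← neg_sub (v t ω), neg_dotProduct, dotProduct_neg, neg_neg]

theorem integral_input_le (d : ℕ → Ω → Fin p → ℝ) {t : ℕ} (ht : t < S.N) :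
    ∫ ω, d t ω ⬝ᵥ d t ω ∂Pr ≤ S.inputEnergy Pr d :=
  Finset.single_le_sum (f := fun s => ∫ ω, d s ω ⬝ᵥ d s ω ∂Pr)
    (fun _ _ => integral_nonneg fun _ => dotProduct_self_nonneg _) (Finset.mem_range.2 ht)

/-- The functional `ℓ` of the input is bounded below by `-ε - C ‖·‖²` for every `ε > 0`. -/
def LowerControlled (S : LQProblem Ω n m p) (Pr : Measure Ω)
    (ℓ : (ℕ → Ω → Fin p → ℝ) → ℝ) : Prop :=
  ∀ ε > 0, ∃ C, 0 ≤ C ∧ ∀ d ∈ S.admissible Pr, -ε - C * S.inputEnergy Pr d ≤ ℓ d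

theorem LowerControlled.add {ℓ ℓ' : (ℕ → Ω → Fin p → ℝ) → ℝ} (h : S.LowerControlled Pr ℓ)
    (h' : S.LowerControlled Pr ℓ') : S.LowerControlled Pr fun d => ℓ d + ℓ' d := by
  intro ε hε
  obtain ⟨C, hC, hb⟩ := h (ε / 2) (half_pos hε)
  obtain ⟨C', hC', hb'⟩ := h' (ε / 2) (half_pos hε)
  refine ⟨C + C', add_nonneg hC hC', fun d hd => ?_⟩
  linarith [hb d hd, hb' d hd]

theorem LowerControlled.sum {T : ℕ} {ℓ : ℕ → (ℕ → Ω → Fin p → ℝ) → ℝ}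
    (h : ∀ t < T, S.LowerControlled Pr (ℓ t)) :
    S.LowerControlled Pr fun d => ∑ t ∈ Finset.range T, ℓ t d := by
  induction T with
  | zero => exact fun ε hε => ⟨0, le_rfl, fun d _ => by simpa using hε.le⟩
  | succ T ih =>
    simp only [Finset.sum_range_succ]
    exact (ih fun t ht => h t (ht.trans T.lt_succ_self)).add (h T T.lt_succ_self)

theorem Standing.cost_nonneg (H : S.Standing Pr) (u : ℕ → Ω → Fin p → ℝ) : 0 ≤ S.cost Pr u := by
  have hQ : ∀ x : Fin n → ℝ, 0 ≤ x ⬝ᵥ (S.Q *ᵥ x) := fun x => by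
    simpa using H.posQ.dotProduct_mulVec_nonneg x
  have hR : ∀ x : Fin p → ℝ, 0 ≤ x ⬝ᵥ (S.R *ᵥ x) := fun x => by
    simpa using H.posR.posSemidef.dotProduct_mulVec_nonneg x
  exact integral_nonneg fun ω =>
    add_nonneg (hQ _) (Finset.sum_nonneg fun t _ => add_nonneg (hQ _) (hR _))

theorem lowerControlled_integral {k : ℕ} {L : (ℕ → Ω → Fin p → ℝ) → Ω → Fin k → ℝ}
    (hL : ∀ d ∈ S.admissible Pr, ∀ i, MemLp (fun ω => L d ω i) 2 Pr) {C : ℝ} (hC : 0 ≤ C)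
    (hb : ∀ d ∈ S.admissible Pr, ∫ ω, L d ω ⬝ᵥ L d ω ∂Pr ≤ C * S.inputEnergy Pr d)
    {y : Ω → Fin k → ℝ} (hy : ∀ i, MemLp (fun ω => y ω i) 2 Pr) :
    S.LowerControlled Pr fun d => ∫ ω, L d ω ⬝ᵥ y ω ∂Pr := by
  intro ε hε
  obtain ⟨C', hC', h⟩ := exists_lower_bound_integral_dotProduct hy hε
  refine ⟨C' * C, mul_nonneg hC' hC, fun d hd => ?_⟩
  have h1 := h _ (hL d hd)
  have h2 := mul_le_mul_of_nonneg_left (hb d hd) hC'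
  linarith

variable [IsProbabilityMeasure Pr]

theorem integrable_input_sq (hu : u ∈ S.admissible Pr) {t : ℕ} (ht : t < S.N) :
    Integrable (fun ω => u t ω ⬝ᵥ u t ω) Pr :=
  integrable_dotProduct (fun i => memLp_two_of_four (memLp_of_admissible hu ht i))
    fun i => memLp_two_of_four (memLp_of_admissible hu ht i)

theorem inputEnergy_add_le (hu : u ∈ S.admissible Pr) (hd : d ∈ S.admissible Pr)
    (hud : u + d ∈ S.admissible Pr) :
    S.inputEnergy Pr (u + d) ≤ 2 * S.inputEnergy Pr u + 2 * S.inputEnergy Pr d := by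
  simp only [inputEnergy, Finset.mul_sum, ← Finset.sum_add_distrib]
  refine Finset.sum_le_sum fun t ht => ?_
  have ht := Finset.mem_range.1 ht
  rw [← integral_const_mul, ← integral_const_mul,
    ← integral_add ((integrable_input_sq hu ht).const_mul 2)
      ((integrable_input_sq hd ht).const_mul 2)]
  exact integral_mono (integrable_input_sq hud ht) (((integrable_input_sq hu ht).const_mul 2).add
    ((integrable_input_sq hd ht).const_mul 2)) fun ω => add_dotProduct_self_le _ _

theorem ae_eq_of_inputEnergy_le_zero (hu : u ∈ S.admissible Pr) (hu' : u' ∈ S.admissible Pr)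
    (h : S.inputEnergy Pr (u - u') ≤ 0) {t : ℕ} (ht : t < S.N) : u t =ᵐ[Pr] u' t := by
  have hd := sub_mem_admissible hu hu'
  have h1 : ∫ ω, (u - u') t ω ⬝ᵥ (u - u') t ω ∂Pr = 0 := by
    refine (Finset.sum_eq_zero_iff_of_nonneg fun s _ => ?_).1
      (le_antisymm h (inputEnergy_nonneg _)) t (Finset.mem_range.2 ht)
    exact integral_nonneg fun _ => dotProduct_self_nonneg _
  rw [integral_eq_zero_iff_of_nonneg (fun _ => dotProduct_self_nonneg _)
    (integrable_input_sq hd ht)] at h1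
  filter_upwards [h1] with ω hω
  exact sub_eq_zero.1 (dotProduct_self_eq_zero.1 hω)

namespace Standing

theorem memLp_prediction (H : S.Standing Pr) (hu : u ∈ S.admissible Pr) {t : ℕ} (ht : t ≤ S.N)
    (i : Fin n) : MemLp (fun ω => S.prediction Pr u t ω i) 4 Pr :=
  (H.memLp_state hu ht i).condExp (by norm_num)

/-- The case `t = N` is included although `F_N` involves the unconstrained `u_N`: conditional
expectation preserves `L⁴` for an arbitrary σ-algebra, being `0` when it is not a sub-σ-algebra. -/
theorem memLp_estimate (H : S.Standing Pr) (hu : u ∈ S.admissible Pr) {t : ℕ} (ht : t ≤ S.N)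
    (i : Fin n) : MemLp (fun ω => S.estimate Pr u t ω i) 4 Pr :=
  (H.memLp_state hu ht i).condExp (by norm_num)

theorem allMoments_weight (H : S.Standing Pr) (hu : u ∈ S.admissible Pr) {t : ℕ} (ht : t < S.N)
    (i j : Fin n) : AllMoments Pr fun ω => (S.Q * S.condCov Pr u t ω * S.Q) i j :=
  allMoments_mul_const (allMoments_const_mul _ fun a b => (H.allMoments_condCov_zero t a b).congr
    ((H.condCov_eq hu ht).mono fun ω hω => by simp only [hω])) _ i j

theorem allMoments_condThird (H : S.Standing Pr) (hu : u ∈ S.admissible Pr) {t : ℕ}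
    (ht : t < S.N) (i : Fin n) : AllMoments Pr fun ω => S.condThird Pr u t ω i :=
  (H.allMoments_condThird_zero t i).congr
    ((H.condThird_eq hu ht).mono fun ω hω => by simp only [hω])

theorem memLp_riskGradient (H : S.Standing Pr) (hu : u ∈ S.admissible Pr) {t : ℕ}
    (ht : t < S.N) (i : Fin n) : MemLp (fun ω => S.riskGradient Pr u t ω i) 2 Pr :=
  ((memLp_two_mulVec (H.allMoments_weight hu ht) (H.memLp_prediction hu ht) i).const_mul 4).add
    (H.allMoments_condThird hu ht i).memLp_two

theorem memLp_two_forced (hd : d ∈ S.admissible Pr) {t : ℕ} (ht : t ≤ S.N) (i : Fin n) :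
    MemLp (fun ω => S.forced d t ω i) 2 Pr :=
  memLp_two_of_four (memLp_forced_of_admissible hd ht i)

theorem memLp_two_input (hd : d ∈ S.admissible Pr) {t : ℕ} (ht : t < S.N) (i : Fin p) :
    MemLp (fun ω => d t ω i) 2 Pr :=
  memLp_two_of_four (memLp_of_admissible hd ht i)

theorem memLp_two_mulVec_state (H : S.Standing Pr) (hu : u ∈ S.admissible Pr) {t : ℕ}
    (ht : t ≤ S.N) (i : Fin n) : MemLp (fun ω => (S.Q *ᵥ S.state u t ω) i) 2 Pr :=
  memLp_const_mulVec S.Q (fun j => memLp_two_of_four (H.memLp_state hu ht j)) i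

theorem memLp_two_mulVec_input (hu : u ∈ S.admissible Pr) {t : ℕ}
    (ht : t < S.N) (i : Fin p) : MemLp (fun ω => (S.R *ᵥ u t ω) i) 2 Pr :=
  memLp_const_mulVec S.R (memLp_two_input hu ht) i

/-- The cost is quadratic with a positive definite second-order part. -/
theorem cost_expansion (H : S.Standing Pr) {c : ℝ}
    (hR : ∀ x : Fin p → ℝ, c * (x ⬝ᵥ x) ≤ x ⬝ᵥ (S.R *ᵥ x))
    (hu : u ∈ S.admissible Pr) (hu' : u' ∈ S.admissible Pr) :
    S.cost Pr u + 2 * S.costSlope Pr u (u' - u) + c * S.inputEnergy Pr (u' - u) ≤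
      S.cost Pr u' := by
  have hd := sub_mem_admissible hu' hu
  set d := u' - u with hdef
  -- The deterministic time-`0` term is split off, so that the state at `t + 1` is paired with the
  -- input at `t`, as in `costSlope`.
  have hsum : ∀ v ∈ S.admissible Pr, S.cost Pr v = S.x0 ⬝ᵥ (S.Q *ᵥ S.x0) +
      ∑ t ∈ Finset.range S.N, (∫ ω, S.state v (t + 1) ω ⬝ᵥ (S.Q *ᵥ S.state v (t + 1) ω) ∂Pr +
        ∫ ω, v t ω ⬝ᵥ (S.R *ᵥ v t ω) ∂Pr) := by
    intro v hv
    have i1 : ∀ t ∈ Finset.range S.N, Integrable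
        (fun ω => S.state v (t + 1) ω ⬝ᵥ (S.Q *ᵥ S.state v (t + 1) ω)) Pr := fun t ht =>
      integrable_dotProduct
        (fun i => memLp_two_of_four (H.memLp_state hv (Finset.mem_range.1 ht) i))
        (H.memLp_two_mulVec_state hv (Finset.mem_range.1 ht))
    have i2 : ∀ t ∈ Finset.range S.N, Integrable (fun ω => v t ω ⬝ᵥ (S.R *ᵥ v t ω)) Pr :=
      fun t ht => integrable_dotProduct (memLp_two_input hv (Finset.mem_range.1 ht))
        (memLp_two_mulVec_input hv (Finset.mem_range.1 ht))
    have e : ∀ ω, (S.state v S.N ω ⬝ᵥ (S.Q *ᵥ S.state v S.N ω) + ∑ t ∈ Finset.range S.N,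
        (S.state v t ω ⬝ᵥ (S.Q *ᵥ S.state v t ω) + v t ω ⬝ᵥ (S.R *ᵥ v t ω))) =
        S.x0 ⬝ᵥ (S.Q *ᵥ S.x0) + ∑ t ∈ Finset.range S.N,
        (S.state v (t + 1) ω ⬝ᵥ (S.Q *ᵥ S.state v (t + 1) ω) + v t ω ⬝ᵥ (S.R *ᵥ v t ω)) := by
      intro ω
      have h1 := Finset.sum_range_succ
        (fun t => S.state v t ω ⬝ᵥ (S.Q *ᵥ S.state v t ω)) S.N
      rw [Finset.sum_range_succ'] at h1
      simp only [Finset.sum_add_distrib]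
      simp only [state] at h1 ⊢
      linarith
    simp only [cost, e]
    have i3 : ∀ t ∈ Finset.range S.N, Integrable (fun ω =>
        S.state v (t + 1) ω ⬝ᵥ (S.Q *ᵥ S.state v (t + 1) ω) + v t ω ⬝ᵥ (S.R *ᵥ v t ω)) Pr :=
      fun t ht => (i1 t ht).add (i2 t ht)
    rw [integral_add (integrable_const _) (integrable_finsetSum _ i3), integral_const,
      probReal_univ, one_smul, integral_finsetSum _ i3]
    congr 1
    exact Finset.sum_congr rfl fun t ht => integral_add (i1 t ht) (i2 t ht)
  rw [hsum u hu, hsum u' hu']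
  simp only [costSlope, inputEnergy, Finset.mul_sum, add_assoc, ← Finset.sum_add_distrib]
  refine add_le_add_right (Finset.sum_le_sum fun t ht => ?_) _
  have ht := Finset.mem_range.1 ht
  have f2 := memLp_two_forced hd (show t + 1 ≤ S.N from ht)
  have x2 := fun i => memLp_two_of_four (H.memLp_state hu (show t + 1 ≤ S.N from ht) i)
  have Qx2 := H.memLp_two_mulVec_state hu (show t + 1 ≤ S.N from ht)
  have Qf2 := memLp_const_mulVec S.Q f2
  have d2 := memLp_two_input hd ht
  have u2 := memLp_two_input hu ht
  have Ru2 := memLp_const_mulVec S.R u2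
  have Rd2 := memLp_const_mulVec S.R d2
  have hx : ∫ ω, S.state u' (t + 1) ω ⬝ᵥ (S.Q *ᵥ S.state u' (t + 1) ω) ∂Pr =
      ∫ ω, S.state u (t + 1) ω ⬝ᵥ (S.Q *ᵥ S.state u (t + 1) ω) ∂Pr +
      2 * ∫ ω, S.forced d (t + 1) ω ⬝ᵥ (S.Q *ᵥ S.state u (t + 1) ω) ∂Pr +
      ∫ ω, S.forced d (t + 1) ω ⬝ᵥ (S.Q *ᵥ S.forced d (t + 1) ω) ∂Pr := by
    have i1 := integrable_dotProduct x2 Qx2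
    have i2 := (integrable_dotProduct f2 Qx2).const_mul 2
    have i3 := integrable_dotProduct f2 Qf2
    rw [← integral_const_mul, ← integral_add i1 i2, ← integral_add (by exact i1.add i2) i3]
    refine integral_congr_ae (ae_of_all _ fun ω => ?_)
    simp only [S.state_eq_add_forced_sub u u', ← hdef,
      quadForm_add (transpose_eq_of_posSemidef H.posQ)]
  have hi : ∫ ω, u' t ω ⬝ᵥ (S.R *ᵥ u' t ω) ∂Pr = ∫ ω, u t ω ⬝ᵥ (S.R *ᵥ u t ω) ∂Pr +
      2 * ∫ ω, d t ω ⬝ᵥ (S.R *ᵥ u t ω) ∂Pr + ∫ ω, d t ω ⬝ᵥ (S.R *ᵥ d t ω) ∂Pr := by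
    have i1 := integrable_dotProduct u2 Ru2
    have i2 := (integrable_dotProduct d2 Ru2).const_mul 2
    have i3 := integrable_dotProduct d2 Rd2
    rw [← integral_const_mul, ← integral_add i1 i2, ← integral_add (by exact i1.add i2) i3]
    refine integral_congr_ae (ae_of_all _ fun ω => ?_)
    have hu'd : u' t ω = u t ω + d t ω := by simp [hdef]
    simp only [hu'd, quadForm_add (transpose_eq_of_posSemidef H.posR.posSemidef)]
  have h1 : 0 ≤ ∫ ω, S.forced d (t + 1) ω ⬝ᵥ (S.Q *ᵥ S.forced d (t + 1) ω) ∂Pr :=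
    integral_nonneg fun ω => by
      simpa using H.posQ.dotProduct_mulVec_nonneg (S.forced d (t + 1) ω)
  have h2 : c * ∫ ω, d t ω ⬝ᵥ d t ω ∂Pr ≤ ∫ ω, d t ω ⬝ᵥ (S.R *ᵥ d t ω) ∂Pr := by
    rw [← integral_const_mul]
    exact integral_mono ((integrable_input_sq hd ht).const_mul c) (integrable_dotProduct d2 Rd2)
      fun ω => hR _
  rw [hx, hi]
  linarith

/-- The risk is convex and quadratic. -/
theorem risk_expansion (H : S.Standing Pr) (hu : u ∈ S.admissible Pr)
    (hu' : u' ∈ S.admissible Pr) :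
    S.risk Pr u + 2 * S.riskSlope Pr u (u' - u) ≤ S.risk Pr u' := by
  have hd := sub_mem_admissible hu' hu
  set d := u' - u with hdef
  have hint : ∀ v ∈ S.admissible Pr, ∀ t < S.N, Integrable (fun ω =>
      4 * (S.prediction Pr v (t + 1) ω ⬝ᵥ
        ((S.Q * S.condCov Pr v t ω * S.Q) *ᵥ S.prediction Pr v (t + 1) ω)) +
      2 * (S.prediction Pr v (t + 1) ω ⬝ᵥ S.condThird Pr v t ω)) Pr := by
    intro v hv t ht
    have hx := fun i => memLp_two_of_four (H.memLp_prediction hv (show t + 1 ≤ S.N from ht) i)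
    exact ((integrable_dotProduct hx (memLp_two_mulVec (H.allMoments_weight hv ht)
      (H.memLp_prediction hv ht))).const_mul 4).add ((integrable_dotProduct hx fun i =>
        (H.allMoments_condThird hv ht i).memLp_two).const_mul 2)
  simp only [risk, riskSlope]
  rw [integral_finsetSum _ fun t ht => hint u hu t (Finset.mem_range.1 ht),
    integral_finsetSum _ fun t ht => hint u' hu' t (Finset.mem_range.1 ht), Finset.mul_sum,
    ← Finset.sum_add_distrib]
  refine Finset.sum_le_sum fun t ht => ?_
  have ht := Finset.mem_range.1 ht
  have i1 := (integrable_dotProduct (memLp_two_forced hd (show t + 1 ≤ S.N from ht))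
    (H.memLp_riskGradient hu ht)).const_mul 2
  rw [← integral_const_mul, ← integral_add (hint u hu t ht) i1]
  refine integral_mono_ae ((hint u hu t ht).add i1) (hint u' hu' t ht) ?_
  -- Both policies share the weight `Q W Q` and the linear coefficient; only the prediction moves,
  -- by the forced response. The discarded remainder is a positive semidefinite form in that
  -- response.
  filter_upwards [H.prediction_eq_add_forced_sub hu hu' ht, H.condCov_eq hu ht,
    H.condCov_eq hu' ht, H.condThird_eq hu ht, H.condThird_eq hu' ht,
    H.condCov_zero_posSemidef t] with ω h1 h2 h3 h4 h5 h6
  have hW : (S.Q * S.condCov Pr 0 t ω * S.Q).PosSemidef := by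
    have := h6.conjTranspose_mul_mul_same S.Q
    rwa [H.posQ.1.eq] at this
  have hn := hW.dotProduct_mulVec_nonneg (S.forced d (t + 1) ω)
  rw [star_trivial] at hn
  simp only [riskGradient, h1, h2, h3, h4, h5, ← hdef]
  rw [quadForm_add (transpose_eq_of_posSemidef hW), add_dotProduct, dotProduct_add,
    dotProduct_smul, smul_eq_mul]
  linarith

/-! ### Costates and stationarity of the Lagrangian -/

theorem prediction_succ (H : S.Standing Pr) (hu : u ∈ S.admissible Pr) {t : ℕ} (ht : t < S.N) :
    S.prediction Pr u (t + 1) =ᵐ[Pr]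
      fun ω => S.A *ᵥ S.estimate Pr u t ω + S.B *ᵥ u t ω + S.wbar Pr := by
  simp only [prediction, pastSigma, estimate, obsSigma_of_admissible hu ht]
  have hx := fun i => (H.memLp_state hu ht.le i).integrable (by norm_num)
  have hA := fun i => (memLp_const_mulVec S.A (H.memLp_state hu ht.le) i).integrable
    (by norm_num)
  have hB := fun i => (memLp_const_mulVec S.B (memLp_of_admissible hu ht) i).integrable
    (by norm_num)
  have h1 := condVec_add (G := S.freeSigma t) (x := fun ω => S.A *ᵥ S.state u t ω + S.B *ᵥ u t ω)
    (fun i => (hA i).add (hB i)) fun i => (H.moments (t + 1) i).integrable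
  have h2 := condVec_add (G := S.freeSigma t) hA hB
  have h3 := condVec_const_mulVec (G := S.freeSigma t) S.A hx
  have h4 := condVec_of_measurable (x := fun ω => S.B *ᵥ u t ω) (H.freeSigma_le t)
    (fun i => (@measurable_pi_apply _ _ _ i).comp
      (measurable_const_mulVec S.B (measurable_of_admissible hu t ht))) hB
  have h5 := condVec_noise H.measurable_w H.measurable_v H.indep H.ident t
  rw [h4] at h2
  filter_upwards [h1, h2, h3, h5] with ω h1 h2 h3 h5
  rw [h2, h3, h5] at h1
  exact h1

theorem stepV_posSemidef_of_admissible (H : S.Standing Pr) {mu : ℝ} (hmu : 0 ≤ mu)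
    (hu : u ∈ S.admissible Pr) {t : ℕ} (ht : t < S.N) :
    ∀ᵐ ω ∂Pr, (S.stepV Pr mu u t (S.costToGo Pr mu u (t + 1)) ω).PosSemidef := by
  filter_upwards [(H.step_costToGo_eq mu hu ht (H.costToGo_eq mu hu ht)).1,
    H.stepV_posSemidef hmu (H.regular_costToGo_zero hmu (show t + 1 ≤ S.N from ht))] with ω h1 h2
  rw [h1]
  exact h2

theorem integral_costate_eq (H : S.Standing Pr) {mu : ℝ} (hmu : 0 ≤ mu)
    (hu : S.IsRiskAwareController Pr mu u) {t : ℕ} (ht : t < S.N) :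
    ∫ ω, S.forced d t ω ⬝ᵥ
        ((S.costToGo Pr mu u t).1 ω *ᵥ S.estimate Pr u t ω + (S.costToGo Pr mu u t).2 ω) ∂Pr =
      ∫ ω, (S.forced d (t + 1) ω ⬝ᵥ
        (S.stepV Pr mu u t (S.costToGo Pr mu u (t + 1)) ω *ᵥ S.prediction Pr u (t + 1) ω +
          S.stepXi Pr mu u t (S.costToGo Pr mu u (t + 1)) ω) +
        d t ω ⬝ᵥ (S.R *ᵥ u t ω)) ∂Pr := by
  obtain ⟨c, hc, hR⟩ := H.posR.exists_coercive
  refine integral_congr_ae ?_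
  filter_upwards [H.stepV_posSemidef_of_admissible hmu hu.1 ht, H.prediction_succ hu.1 ht,
    hu.2 t ht] with ω hV hx hu
  rw [hx, costToGo_step _ _ _ _ _ ht]
  exact costate_step (transpose_eq_of_posSemidef hV)
    (transpose_eq_of_posSemidef H.posR.posSemidef)
    (isUnit_of_coercive hc (hV.coercive_conj_add S.B hR)) rfl rfl rfl rfl rfl hu

/-- The response and the prediction at `t + 1` are `F_t`-measurable, so the conditional expectations
inside `V_t` and `ξ_t` disappear under the integral. Splitting the estimate into prediction plus
refinement error produces the term `E(P_{t+1} e_{t+1} | F_t)` of `ξ_t`. -/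
theorem integral_costate_succ (H : S.Standing Pr) {mu : ℝ} (hmu : 0 ≤ mu)
    (hu : u ∈ S.admissible Pr) (hd : d ∈ S.admissible Pr) {t : ℕ} (ht : t < S.N) :
    ∫ ω, S.forced d (t + 1) ω ⬝ᵥ
        (S.stepV Pr mu u t (S.costToGo Pr mu u (t + 1)) ω *ᵥ S.prediction Pr u (t + 1) ω +
          S.stepXi Pr mu u t (S.costToGo Pr mu u (t + 1)) ω) ∂Pr =
      ∫ ω, S.forced d (t + 1) ω ⬝ᵥ (S.Q *ᵥ S.state u (t + 1) ω) ∂Pr +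
      mu * ∫ ω, S.forced d (t + 1) ω ⬝ᵥ S.riskGradient Pr u t ω ∂Pr +
      ∫ ω, S.forced d (t + 1) ω ⬝ᵥ ((S.costToGo Pr mu u (t + 1)).1 ω *ᵥ
        S.estimate Pr u (t + 1) ω + (S.costToGo Pr mu u (t + 1)).2 ω) ∂Pr := by
  have ht1 : t + 1 ≤ S.N := ht
  obtain ⟨-, hP, hZ⟩ := H.regular_costToGo hmu hu ht1
  set next := S.costToGo Pr mu u (t + 1) with hnext
  have hG := obsSigma_of_admissible hu ht
  have hle := H.freeSigma_le t
  have fm : ∀ i, Measurable[S.freeSigma t] fun ω => S.forced d (t + 1) ω i := fun i =>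
    (@measurable_pi_apply _ _ _ i).comp (measurable_forced_succ hd ht)
  have f4 := memLp_forced_of_admissible hd ht1
  have f2 := memLp_two_forced hd ht1
  have x4 := H.memLp_prediction hu ht1
  have hpred : S.prediction Pr u (t + 1) = condVec Pr (S.freeSigma t) (S.state u (t + 1)) := by
    simp only [prediction, pastSigma, hG]
  have xm : ∀ i, Measurable[S.freeSigma t] fun ω => S.prediction Pr u (t + 1) ω i := by
    rw [hpred]
    exact measurable_condVec
  have e4 : ∀ i, MemLp (fun ω => S.refineErr Pr u (t + 1) ω i) 4 Pr := fun i =>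
    (H.memLp_estimate hu ht1 i).sub (x4 i)
  set y : Ω → Fin n → ℝ := fun ω => next.1 ω *ᵥ S.refineErr Pr u (t + 1) ω + next.2 ω with hy
  have y2 : ∀ i, MemLp (fun ω => y ω i) 2 Pr := fun i =>
    (memLp_two_mulVec hP e4 i).add (hZ i).memLp_two
  have Ey2 : ∀ i, MemLp (fun ω => condVec Pr (S.freeSigma t) y ω i) 2 Pr := fun i =>
    (y2 i).condExp one_le_two
  have EP : ∀ i j, AllMoments Pr fun ω => condMat Pr (S.freeSigma t) next.1 ω i j := fun i j =>
    (hP i j).condExp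
  have Qx2 := memLp_const_mulVec S.Q fun i => memLp_two_of_four (x4 i)
  have j1 := integrable_dotProduct f2 (memLp_two_mulVec EP x4)
  have j2 := integrable_dotProduct f2 Qx2
  have j3 := (integrable_dotProduct f2 (H.memLp_riskGradient hu ht)).const_mul mu
  have j4 := integrable_dotProduct f2 Ey2
  have hQ : ∫ ω, S.forced d (t + 1) ω ⬝ᵥ (S.Q *ᵥ S.state u (t + 1) ω) ∂Pr =
      ∫ ω, S.forced d (t + 1) ω ⬝ᵥ (S.Q *ᵥ S.prediction Pr u (t + 1) ω) ∂Pr := by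
    rw [integral_dotProduct_condVec hle fm f2 (H.memLp_two_mulVec_state hu ht1)]
    refine integral_congr_ae ?_
    filter_upwards [condVec_const_mulVec (G := S.freeSigma t) S.Q
      fun i => (H.memLp_state hu ht1 i).integrable (by norm_num)] with ω hω
    rw [hω, hpred]
  have hD : ∫ ω, S.forced d (t + 1) ω ⬝ᵥ (next.1 ω *ᵥ S.estimate Pr u (t + 1) ω + next.2 ω) ∂Pr =
      ∫ ω, S.forced d (t + 1) ω ⬝ᵥ (condMat Pr (S.freeSigma t) next.1 ω *ᵥ
        S.prediction Pr u (t + 1) ω) ∂Pr +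
      ∫ ω, S.forced d (t + 1) ω ⬝ᵥ condVec Pr (S.freeSigma t) y ω ∂Pr := by
    rw [← integral_dotProduct_condVec hle fm f2 y2,
      ← integral_dotProduct_condMat_mulVec hle fm xm f4 x4 fun i j => (hP i j).memLp_two,
      ← integral_add (integrable_dotProduct f2 (memLp_two_mulVec hP x4))
        (integrable_dotProduct f2 y2)]
    refine integral_congr_ae (ae_of_all _ fun ω => ?_)
    simp only [hy, refineErr, mulVec_sub, ← dotProduct_add]
    congr 1
    abel
  rw [hQ, hD, ← integral_const_mul, ← integral_add j1 j4, ← integral_add j2 j3,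
    ← integral_add (by exact j2.add j3) (by exact j1.add j4)]
  refine integral_congr_ae (ae_of_all _ fun ω => ?_)
  simp only [stepV, stepXi, inflatedPenalty, riskGradient, hG, ← hy, add_mulVec, smul_mulVec,
    dotProduct_add, dotProduct_smul, smul_eq_mul]
  ring

/-- The risk-aware controller is a stationary point of the Lagrangian. -/
theorem slope_eq_zero (H : S.Standing Pr) {mu : ℝ} (hmu : 0 ≤ mu)
    (hu : S.IsRiskAwareController Pr mu u) (hd : d ∈ S.admissible Pr) :
    S.costSlope Pr u d + mu * S.riskSlope Pr u d = 0 := by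
  -- Pairing of the response with the costate `P_t x̂_{t|t} + ζ_t`. It vanishes at `0` because the
  -- response starts at `0`, and at `N` by the terminal condition.
  set D : ℕ → ℝ := fun t => ∫ ω, S.forced d t ω ⬝ᵥ
    ((S.costToGo Pr mu u t).1 ω *ᵥ S.estimate Pr u t ω + (S.costToGo Pr mu u t).2 ω) ∂Pr with hD
  have h0 : D 0 = 0 := by simp [hD, forced]
  have hN : D S.N = 0 := by simp [hD, costToGo_terminal]
  have hstep : ∀ t ∈ Finset.range S.N,
      (∫ ω, S.forced d (t + 1) ω ⬝ᵥ (S.Q *ᵥ S.state u (t + 1) ω) ∂Pr +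
        ∫ ω, d t ω ⬝ᵥ (S.R *ᵥ u t ω) ∂Pr) +
      mu * ∫ ω, S.forced d (t + 1) ω ⬝ᵥ S.riskGradient Pr u t ω ∂Pr = D t - D (t + 1) := by
    intro t ht
    have ht := Finset.mem_range.1 ht
    have h1 := H.integral_costate_eq (d := d) hmu hu ht
    have hn := H.regular_costToGo_zero hmu (show t + 1 ≤ S.N from ht)
    obtain ⟨hV, hX⟩ := H.step_costToGo_eq mu hu.1 ht (H.costToGo_eq mu hu.1 ht)
    have hV2 := memLp_two_mulVec (M := S.stepV Pr mu u t (S.costToGo Pr mu u (t + 1)))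
      (fun i j => (H.allMoments_stepV (mu := mu) (t := t) hn i j).congr
        (hV.mono fun ω hω => by simp only [hω])) (H.memLp_prediction hu.1 ht)
    have hX2 : ∀ i, MemLp
        (fun ω => S.stepXi Pr mu u t (S.costToGo Pr mu u (t + 1)) ω i) 2 Pr := fun i =>
      ((H.allMoments_stepXi (mu := mu) (t := t) hn i).congr
        (hX.mono fun ω hω => by simp only [hω])).memLp_two
    have i1 := integrable_dotProduct (y := fun ω =>
      S.stepV Pr mu u t (S.costToGo Pr mu u (t + 1)) ω *ᵥ S.prediction Pr u (t + 1) ω +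
        S.stepXi Pr mu u t (S.costToGo Pr mu u (t + 1)) ω)
      (memLp_two_forced hd (show t + 1 ≤ S.N from ht)) fun i => (hV2 i).add (hX2 i)
    rw [integral_add i1
      (integrable_dotProduct (memLp_two_input hd ht) (memLp_two_mulVec_input hu.1 ht)),
      H.integral_costate_succ hmu hu.1 hd ht] at h1
    simp only [hD]
    rw [h1]
    ring
  rw [costSlope, riskSlope, Finset.mul_sum, ← Finset.sum_add_distrib,
    Finset.sum_congr rfl hstep, Finset.sum_range_sub', h0, hN, sub_zero]

/-- With the first-order terms cancelling, the expansions leave only the curvature, and the gap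
comes from the input penalty `R` alone. -/
theorem lagrangian_le (H : S.Standing Pr) {c : ℝ}
    (hR : ∀ x : Fin p → ℝ, c * (x ⬝ᵥ x) ≤ x ⬝ᵥ (S.R *ᵥ x)) {mu : ℝ} (hmu : 0 ≤ mu)
    (hu : S.IsRiskAwareController Pr mu u) (hu' : u' ∈ S.admissible Pr) :
    S.cost Pr u + mu * S.risk Pr u + c * S.inputEnergy Pr (u' - u) ≤
      S.cost Pr u' + mu * S.risk Pr u' := by
  have h1 := H.cost_expansion hR hu.1 hu'
  have h2 := mul_le_mul_of_nonneg_left (H.risk_expansion hu.1 hu') hmu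
  have h3 := H.slope_eq_zero hmu hu (sub_mem_admissible hu' hu.1)
  linarith

end Standing

/-! ### Lower semicontinuity of cost and risk -/

/-- Continuity of input-to-state response in mean square. It makes the slopes continuous linear
functionals of the direction for the norm in which the Lagrangian gap is measured. -/
theorem exists_integral_forced_le (S : LQProblem Ω n m p) (Pr : Measure Ω)
    [IsProbabilityMeasure Pr] (t : ℕ) (ht : t ≤ S.N) : ∃ C, 0 ≤ C ∧ ∀ d ∈ S.admissible Pr,
      ∫ ω, S.forced d t ω ⬝ᵥ S.forced d t ω ∂Pr ≤ C * S.inputEnergy Pr d := by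
  induction t with
  | zero => exact ⟨0, le_rfl, fun d _ => by simp [forced]⟩
  | succ t ih =>
    obtain ⟨C, hC, h⟩ := ih (t.le_succ.trans ht)
    obtain ⟨a, ha, hA⟩ := mulVec_dotProduct_self_le S.A
    obtain ⟨b, hb, hB⟩ := mulVec_dotProduct_self_le S.B
    refine ⟨2 * a * C + 2 * b, by positivity, fun d hd => ?_⟩
    have f2 := Standing.memLp_two_forced hd (t.le_succ.trans ht)
    have f2' := Standing.memLp_two_forced hd ht
    have i1 := (integrable_dotProduct f2 f2).const_mul (2 * a)
    have i2 := (integrable_input_sq hd ht).const_mul (2 * b)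
    have h1 : ∫ ω, S.forced d (t + 1) ω ⬝ᵥ S.forced d (t + 1) ω ∂Pr ≤
        ∫ ω, (2 * a * (S.forced d t ω ⬝ᵥ S.forced d t ω) + 2 * b * (d t ω ⬝ᵥ d t ω)) ∂Pr := by
      refine integral_mono (integrable_dotProduct f2' f2') (i1.add i2) fun ω => ?_
      have h2 := add_dotProduct_self_le (S.A *ᵥ S.forced d t ω) (S.B *ᵥ d t ω)
      have h3 := hA (S.forced d t ω)
      have h4 := hB (d t ω)
      simp only [forced]
      linarith
    rw [integral_add i1 i2, integral_const_mul, integral_const_mul] at h1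
    have h2 := mul_le_mul_of_nonneg_left (h d hd) (by positivity : 0 ≤ 2 * a)
    have h3 := mul_le_mul_of_nonneg_left (integral_input_le (S := S) (Pr := Pr) d ht)
      (by positivity : 0 ≤ 2 * b)
    linarith

namespace Standing

theorem lowerControlled_forced {t : ℕ} (ht : t < S.N) {y : Ω → Fin n → ℝ}
    (hy : ∀ i, MemLp (fun ω => y ω i) 2 Pr) :
    S.LowerControlled Pr fun d => ∫ ω, S.forced d (t + 1) ω ⬝ᵥ y ω ∂Pr := by
  obtain ⟨C, hC, h⟩ := exists_integral_forced_le S Pr (t + 1) ht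
  exact lowerControlled_integral (fun d hd => memLp_two_forced hd ht) hC h hy

theorem lowerControlled_costSlope (H : S.Standing Pr) (hu : u ∈ S.admissible Pr) :
    S.LowerControlled Pr (S.costSlope Pr u) :=
  LowerControlled.sum fun _ ht =>
    (lowerControlled_forced ht (H.memLp_two_mulVec_state hu ht)).add
      (lowerControlled_integral (fun _ hd => memLp_two_input hd ht) zero_le_one
        (fun d _ => by rw [one_mul]; exact integral_input_le d ht) (memLp_two_mulVec_input hu ht))

theorem lowerControlled_riskSlope (H : S.Standing Pr) (hu : u ∈ S.admissible Pr) :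
    S.LowerControlled Pr (S.riskSlope Pr u) :=
  LowerControlled.sum fun _ ht => lowerControlled_forced ht (H.memLp_riskGradient hu ht)

/-- Convexity bounds the cost below by its linearization, whose slope is controlled; `ε / 2` is used
because the slope enters twice. The risk is treated likewise. -/
theorem cost_lowerSemicontinuous (H : S.Standing Pr) (hu : u ∈ S.admissible Pr) {ε : ℝ}
    (hε : 0 < ε) : ∃ C, 0 ≤ C ∧ ∀ v ∈ S.admissible Pr,
      S.cost Pr u - ε - C * S.inputEnergy Pr (v - u) ≤ S.cost Pr v := by
  obtain ⟨c, hc, hR⟩ := H.posR.exists_coercive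
  obtain ⟨C, hC, h⟩ := H.lowerControlled_costSlope hu (ε / 2) (half_pos hε)
  refine ⟨2 * C, by positivity, fun v hv => ?_⟩
  have h1 := h _ (sub_mem_admissible hv hu)
  have h2 := H.cost_expansion hR hu hv
  have h3 := mul_nonneg hc.le (inputEnergy_nonneg (S := S) (Pr := Pr) (v - u))
  linarith

theorem risk_lowerSemicontinuous (H : S.Standing Pr) (hu : u ∈ S.admissible Pr) {ε : ℝ}
    (hε : 0 < ε) : ∃ C, 0 ≤ C ∧ ∀ v ∈ S.admissible Pr,
      S.risk Pr u - ε - C * S.inputEnergy Pr (v - u) ≤ S.risk Pr v := by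
  obtain ⟨C, hC, h⟩ := H.lowerControlled_riskSlope hu (ε / 2) (half_pos hε)
  refine ⟨2 * C, by positivity, fun v hv => ?_⟩
  have h1 := h _ (sub_mem_admissible hv hu)
  have h2 := H.risk_expansion hu hv
  linarith

end Standing

end Optimality

end LQProblem

/-! ### The main theorem -/

theorem mainTheorem6 {Ω : Type*} [MeasurableSpace Ω] (Pr : Measure Ω) [IsProbabilityMeasure Pr]
    {n m p : ℕ} (S : LQProblem Ω n m p)
    (hQ : S.Q.PosSemidef) (hR : S.R.PosDef)
    (hw : ∀ t, Measurable (S.w t)) (hv : ∀ t, Measurable (S.v t))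
    (hindep : iIndepFun (fun t ω => (S.w t ω, S.v t ω)) Pr)
    (hident : ∀ t, IdentDistrib (fun ω => (S.w t ω, S.v t ω)) (fun ω => (S.w 0 ω, S.v 0 ω)) Pr Pr)
    (hmoments : ∀ (t q : ℕ), MemLp (S.w t) (q : ENNReal) Pr) :
    (∀ mu : ℝ, 0 ≤ mu → ∃ u, S.IsRiskAwareController Pr mu u) ∧
    ∀ ustar : ℝ → ℕ → Ω → (Fin p → ℝ),
      (∀ mu : ℝ, 0 ≤ mu → S.IsRiskAwareController Pr mu (ustar mu)) →
      ∀ epsBar : ℝ, sInf (S.risk Pr '' S.admissible Pr) < epsBar →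
        (S.feasible Pr epsBar).Nonempty ∧
        (S.multiplierSet Pr epsBar ustar).Nonempty ∧
        S.IsOptimal Pr epsBar (ustar (sInf (S.multiplierSet Pr epsBar ustar))) ∧
        ∀ u, S.IsOptimal Pr epsBar u → ∀ t < S.N,
          u t =ᵐ[Pr] ustar (sInf (S.multiplierSet Pr epsBar ustar)) t := by
  have H : S.Standing Pr := ⟨hQ, hR, hw, hv, hindep, hident, fun t i q =>
    memLp_pi_iff.1 (hmoments t q) i⟩
  refine ⟨fun mu hmu => H.exists_isRiskAwareController hmu, fun ustar hustar epsBar heps => ?_⟩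
  obtain ⟨c, hc, hRc⟩ := hR.exists_coercive
  -- Only non-emptiness of the set of risks is needed: were it unbounded below, `sInf` would be the
  -- default `0`, and a policy of smaller risk would still exist.
  obtain ⟨_, ⟨u0, hu0, rfl⟩, hu0e⟩ := exists_lt_of_csInf_lt
    (Set.image_nonempty.2 ⟨0, LQProblem.zero_mem_admissible⟩) heps
  obtain ⟨hne, hpos, hfeas, hopt⟩ := lagrange_smallest_multiplier (adm := S.admissible Pr)
    (J := S.cost Pr) (Rk := S.risk Pr) (D := fun u v => S.inputEnergy Pr (u - v)) hc
    (fun u _ => H.cost_nonneg u) (fun _ _ _ _ => LQProblem.inputEnergy_nonneg _)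
    (fun u _ v _ => LQProblem.inputEnergy_sub_comm u v)
    (fun u hu v hv w hw => by
      have h := LQProblem.inputEnergy_add_le (LQProblem.sub_mem_admissible hu hv)
        (LQProblem.sub_mem_admissible hv hw)
        (by rw [sub_add_sub_cancel]; exact LQProblem.sub_mem_admissible hu hw)
      rwa [sub_add_sub_cancel] at h)
    (fun u hu ε hε => H.cost_lowerSemicontinuous hu hε)
    (fun u hu ε hε => H.risk_lowerSemicontinuous hu hε)
    (fun mu hmu => (hustar mu hmu).1)
    (fun mu hmu v hv => H.lagrangian_le hRc hmu (hustar mu hmu) hv)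
    ⟨u0, hu0, hu0e⟩ (S := S.multiplierSet Pr epsBar ustar) rfl
  have hadm := (hustar _ hpos).1
  refine ⟨⟨u0, hu0, hu0e.le⟩, hne, ⟨⟨hadm, hfeas⟩, fun v hv => ?_⟩, fun u hu t ht => ?_⟩
  · have h1 := hopt v hv.1 hv.2
    have h2 := mul_nonneg (half_pos hc).le (LQProblem.inputEnergy_nonneg (S := S) (Pr := Pr)
      (v - ustar (sInf (S.multiplierSet Pr epsBar ustar))))
    linarith
  · have h1 := hopt u hu.1.1 hu.1.2
    have h2 := hu.2 _ ⟨hadm, hfeas⟩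
    refine LQProblem.ae_eq_of_inputEnergy_le_zero hu.1.1 hadm ?_ ht
    -- An optimal `u` costs no more than `ustar` at the smallest multiplier, so the surviving
    -- quadratic gap must vanish.
    have h3 : c / 2 * S.inputEnergy Pr
        (u - ustar (sInf (S.multiplierSet Pr epsBar ustar))) ≤ c / 2 * 0 := by linarith
    exact le_of_mul_le_mul_left h3 (half_pos hc)
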